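/- For $n\ge 2$, let $\mathcal G_n$ be the graph whose vertices are the non-crossing straight-line perfect matchings on $2n$ points placed equidistantly on the unit circle. Two matchings are adjacent in $\mathcal G_n$ if they differ in a flip: two edges of one matching that span an empty quadrilateral (their convex hull meets no other edge of the matching) are replaced by the other two sides of this quadrilateral. A cycle in $\mathcal G_n$ is a nontrivial closed walk that repeats no vertex other than its start as its end (walking back and forth along one edge counts as a cycle of length $2$). For an integer $r\ge 1$, an $r$-rainbow cycle is a cycle in $\mathcal G_n$ along which every possible matching edge (every segment that belongs to some non-crossing perfect matching on the $2n$ points) appears in exactly $r$ of the flips. Moreover, let $N_1(n,k)=\frac{2}{n+1}\binom{n+1}{k}\binom{n-2}{k-1}$ for $1\le k\le n-1$. **Theorem.** For every odd $n\ge 3$ and every integer $r\ge 1$, there is no $r$-rainbow cycle in $\mathcal G_n$. For every even $n\ge 2$ and every integer $r>\frac{2}{n^2}N_1(n,n/2)$, there is no $r$-rainbow cycle in $\mathcal G_n$. -/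

import Mathlib

/-- The `i`-th of `2 * n` points placed equidistantly on the unit circle in the plane `ℂ`. -/
noncomputable def circlePoint (n : ℕ) (i : Fin (2 * n)) : ℂ :=
  Complex.exp (((2 * Real.pi * (i : ℕ) / (2 * n : ℕ) : ℝ) : ℂ) * Complex.I)

/-- The convex hull in the plane of the points whose labels lie in `s`. -/
noncomputable def pointHull (n : ℕ) (s : Set (Fin (2 * n))) : Set ℂ :=
  convexHull ℝ (circlePoint n '' s)

/-- The closed straight-line segment joining the two endpoints of `e`. -/
noncomputable def chord (n : ℕ) (e : Sym2 (Fin (2 * n))) : Set ℂ :=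
  pointHull n {i | i ∈ e}

/-- A non-crossing straight-line perfect matching on `2 * n` equidistant points on the unit
circle, given by its set of edges. -/
@[ext]
structure NCMatching (n : ℕ) where
  edges : Finset (Sym2 (Fin (2 * n)))
  not_isDiag : ∀ e ∈ edges, ¬ e.IsDiag
  perfect : ∀ i : Fin (2 * n), ∃! e, e ∈ edges ∧ i ∈ e
  noncrossing : ∀ e ∈ edges, ∀ f ∈ edges, e ≠ f → Disjoint (chord n e) (chord n f)

/-- `IsFlip M M'`: the edges `ab` and `cd` of `M` span an empty quadrilateral (no other edge of
`M` meets their convex hull), and `M'` arises from `M` by replacing them with `bc` and `da`.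
As `ab`, `cd` do not cross (in `M`) and `bc`, `da` do not cross (in `M'`), these are the two
pairs of opposite sides of the quadrilateral, and not its diagonals. -/
def IsFlip {n : ℕ} (M M' : NCMatching n) : Prop :=
  ∃ a b c d : Fin (2 * n),
    s(a, b) ∈ M.edges ∧ s(c, d) ∈ M.edges ∧ s(a, b) ≠ s(c, d) ∧
    (∀ g ∈ M.edges, g ≠ s(a, b) → g ≠ s(c, d) →
      Disjoint (chord n g) (pointHull n {a, b, c, d})) ∧
    M'.edges = (M.edges \ {s(a, b), s(c, d)}) ∪ {s(b, c), s(d, a)}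

theorem NCMatching.eq_of_mem {n : ℕ} (M : NCMatching n) {i : Fin (2 * n)}
    {e f : Sym2 (Fin (2 * n))} (he : e ∈ M.edges) (hf : f ∈ M.edges) (hie : i ∈ e)
    (hif : i ∈ f) : e = f :=
  (M.perfect i).unique ⟨he, hie⟩ ⟨hf, hif⟩

theorem NCMatching.four_distinct {n : ℕ} (M : NCMatching n) {a b c d : Fin (2 * n)}
    (h1 : s(a, b) ∈ M.edges) (h2 : s(c, d) ∈ M.edges) (h : s(a, b) ≠ s(c, d)) :
    a ≠ b ∧ a ≠ c ∧ a ≠ d ∧ b ≠ c ∧ b ≠ d ∧ c ≠ d := by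
  have key : ∀ i, i ∈ s(a, b) → i ∉ s(c, d) := fun i hi hi' => h (M.eq_of_mem h1 h2 hi hi')
  refine ⟨fun e => M.not_isDiag _ h1 (by simp [e]), ?_, ?_, ?_, ?_,
    fun e => M.not_isDiag _ h2 (by simp [e])⟩
  · exact fun e => key a (by simp) (by simp [e])
  · exact fun e => key a (by simp) (by simp [e])
  · exact fun e => key b (by simp) (by simp [e])
  · exact fun e => key b (by simp) (by simp [e])

theorem IsFlip.ne {n : ℕ} {M M' : NCMatching n} (h : IsFlip M M') : M ≠ M' := by
  rintro rfl
  obtain ⟨a, b, c, d, h1, h2, h12, -, hM⟩ := h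
  obtain ⟨-, hac, -, -, -, -⟩ := M.four_distinct h1 h2 h12
  have h3 : s(b, c) ∈ M.edges := by rw [hM]; simp
  have := M.eq_of_mem h1 h3 (Sym2.mem_mk_right a b) (Sym2.mem_mk_left b c)
  rw [Sym2.eq_swap, Sym2.congr_right] at this
  exact hac this

theorem IsFlip.symm {n : ℕ} {M M' : NCMatching n} (h : IsFlip M M') : IsFlip M' M := by
  obtain ⟨a, b, c, d, h1, h2, h12, hE, hM⟩ := h
  obtain ⟨hab, hac, had, hbc, hbd, hcd⟩ := M.four_distinct h1 h2 h12
  have h3 : s(b, c) ∉ M.edges := fun h3 => by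
    have := M.eq_of_mem h1 h3 (Sym2.mem_mk_right a b) (Sym2.mem_mk_left b c)
    rw [Sym2.eq_swap, Sym2.congr_right] at this
    exact hac this
  have h4 : s(d, a) ∉ M.edges := fun h4 => by
    have := M.eq_of_mem h1 h4 (Sym2.mem_mk_left a b) (Sym2.mem_mk_right d a)
    rw [Sym2.eq_swap, Sym2.congr_left] at this
    exact hbd this
  refine ⟨b, c, d, a, by rw [hM]; simp, by rw [hM]; simp, ?_, ?_, ?_⟩
  · intro e
    rw [Sym2.eq_iff] at e
    rcases e with ⟨e, -⟩ | ⟨e, -⟩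
    · exact hbd e
    · exact hab e.symm
  · intro g hg hg1 hg2
    have : ({b, c, d, a} : Set (Fin (2 * n))) = {a, b, c, d} := by
      ext x; simp only [Set.mem_insert_iff, Set.mem_singleton_iff]; tauto
    rw [this]
    rw [hM] at hg
    simp only [Finset.mem_union, Finset.mem_sdiff, Finset.mem_insert, Finset.mem_singleton,
      not_or] at hg
    rcases hg with ⟨hg, hga, hgb⟩ | hg | hg
    · exact hE g hg hga hgb
    · exact absurd hg hg1
    · exact absurd hg hg2
  · ext g
    rw [hM]
    simp only [Finset.mem_union, Finset.mem_sdiff, Finset.mem_insert, Finset.mem_singleton]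
    by_cases g1 : g = s(a, b)
    · subst g1; simp [h1]
    by_cases g2 : g = s(c, d)
    · subst g2; simp [h2]
    by_cases g3 : g = s(b, c)
    · subst g3; simp [h3, g1, g2]
    by_cases g4 : g = s(d, a)
    · subst g4; simp [h4, g1, g2]
    simp [g1, g2, g3, g4]

/-- The flip graph of non-crossing perfect matchings on `2 * n` points. -/
def flipGraph (n : ℕ) : SimpleGraph (NCMatching n) where
  Adj := IsFlip
  symm := ⟨fun _ _ h => h.symm⟩
  loopless := ⟨fun _ h => h.ne rfl⟩

/-- A cycle: a nontrivial closed walk that repeats no vertex, apart from its last vertex being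
its first. Walking back and forth along one edge counts as a (degenerate) cycle of length `2`. -/
def IsFlipCycle {n : ℕ} {M : NCMatching n} (p : (flipGraph n).Walk M M) : Prop :=
  0 < p.length ∧ p.support.tail.Nodup

open Classical in
/-- The number of flips along the walk `p` in which the edge `e` appears. -/
noncomputable def appearances {n : ℕ} {M M' : NCMatching n} (p : (flipGraph n).Walk M M')
    (e : Sym2 (Fin (2 * n))) : ℕ :=
  p.darts.countP fun d => e ∉ d.fst.edges ∧ e ∈ d.snd.edges

/-- An edge between two of the points is a possible matching edge if it is contained in some
non-crossing perfect matching. -/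
def IsPossibleEdge {n : ℕ} (e : Sym2 (Fin (2 * n))) : Prop :=
  ∃ M : NCMatching n, e ∈ M.edges

/-- An `r`-rainbow cycle: every possible matching edge appears exactly `r` times in flips
along the cycle. -/
def IsRainbowCycle {n : ℕ} (r : ℕ) {M : NCMatching n} (p : (flipGraph n).Walk M M) : Prop :=
  IsFlipCycle p ∧ ∀ e : Sym2 (Fin (2 * n)), IsPossibleEdge e → appearances p e = r

/-- The generalized Narayana number `N_r(n, k)`, for `n ≥ 1`, `r ≥ 0` and `1 ≤ k ≤ n - r`. -/
def narayana (r n k : ℕ) : ℚ :=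
  ((r : ℚ) + 1) / ((n : ℚ) + 1) * ((n + 1).choose k : ℚ) * ((n - r - 1).choose (k - 1) : ℚ)

/-- Twice the signed area of the triangle `x y z`. -/
def signedArea (x y z : ℂ) : ℝ := (y.re - x.re) * (z.im - x.im) - (y.im - x.im) * (z.re - x.re)

theorem chord_mk (n : ℕ) (a b : Fin (2 * n)) :
    chord n s(a, b) = segment ℝ (circlePoint n a) (circlePoint n b) := by
  have : {i | i ∈ s(a, b)} = ({a, b} : Set (Fin (2 * n))) := by ext; simp
  rw [chord, pointHull, this, Set.image_pair, convexHull_pair]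

theorem signedArea_circlePoint (n : ℕ) (i j k : Fin (2 * n)) :
    signedArea (circlePoint n i) (circlePoint n j) (circlePoint n k) =
      4 * Real.sin (Real.pi * (((j : ℕ) : ℝ) - (i : ℕ)) / (2 * n))
        * Real.sin (Real.pi * (((k : ℕ) : ℝ) - (j : ℕ)) / (2 * n))
        * Real.sin (Real.pi * (((k : ℕ) : ℝ) - (i : ℕ)) / (2 * n)) := by
  have e (i : Fin (2 * n)) : 2 * Real.pi * ((i : ℕ) : ℝ) / ((2 * n : ℕ) : ℝ)
      = 2 * (Real.pi * ((i : ℕ) : ℝ) / (2 * n)) := by push_cast; ring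
  have f (i j : Fin (2 * n)) : Real.pi * (((j : ℕ) : ℝ) - (i : ℕ)) / (2 * n)
      = Real.pi * ((j : ℕ) : ℝ) / (2 * n) - Real.pi * ((i : ℕ) : ℝ) / (2 * n) := by ring
  simp only [signedArea, circlePoint, Complex.exp_ofReal_mul_I_re, Complex.exp_ofReal_mul_I_im,
    e, f]
  generalize Real.pi * ((i : ℕ) : ℝ) / (2 * n) = x
  generalize Real.pi * ((j : ℕ) : ℝ) / (2 * n) = y
  generalize Real.pi * ((k : ℕ) : ℝ) / (2 * n) = z
  have h (u v : ℝ) : Real.cos (2 * u) - Real.cos (2 * v) = -2 * Real.sin (u + v) * Real.sin (u - v) := by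
    rw [Real.cos_sub_cos]; congr 3 <;> ring
  have h' (u v : ℝ) : Real.sin (2 * u) - Real.sin (2 * v) = 2 * Real.sin (u - v) * Real.cos (u + v) := by
    rw [Real.sin_sub_sin]; congr 3 <;> ring
  have h3 : Real.sin (z - y) =
      Real.sin (z + x) * Real.cos (y + x) - Real.cos (z + x) * Real.sin (y + x) := by
    rw [← Real.sin_sub]; congr 1; ring
  rw [h, h, h', h', h3]
  ring

theorem sin_index_pos {n : ℕ} {i j : Fin (2 * n)} (h : i < j) :
    0 < Real.sin (Real.pi * (((j : ℕ) : ℝ) - (i : ℕ)) / (2 * n)) := by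
  have hj : ((j : ℕ) : ℝ) < 2 * n := by exact_mod_cast j.2
  have hi : (0 : ℝ) ≤ ((i : ℕ) : ℝ) := by positivity
  have hij : ((i : ℕ) : ℝ) < ((j : ℕ) : ℝ) := by exact_mod_cast h
  have hn : (0 : ℝ) < 2 * n := by linarith
  apply Real.sin_pos_of_pos_of_lt_pi
  · have := Real.pi_pos
    have : 0 < ((j : ℕ) : ℝ) - (i : ℕ) := by linarith
    positivity
  · rw [div_lt_iff₀ hn]
    have := Real.pi_pos
    nlinarith

theorem sin_index_neg {n : ℕ} {i j : Fin (2 * n)} (h : j < i) :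
    Real.sin (Real.pi * (((j : ℕ) : ℝ) - (i : ℕ)) / (2 * n)) < 0 := by
  have := sin_index_pos h
  rw [← neg_pos, ← Real.sin_neg]
  convert this using 2
  ring

theorem signedArea_neg_of_between {n : ℕ} {a b c : Fin (2 * n)} (h1 : a < c) (h2 : c < b) :
    signedArea (circlePoint n a) (circlePoint n b) (circlePoint n c) < 0 := by
  rw [signedArea_circlePoint]
  have hab := sin_index_pos (h1.trans h2)
  have hac := sin_index_pos h1
  have hbc := sin_index_neg h2
  exact mul_neg_of_neg_of_pos (mul_neg_of_pos_of_neg (by positivity) hbc) hac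

theorem signedArea_pos_of_outside {n : ℕ} {a b c : Fin (2 * n)} (hab : a < b)
    (h : c < a ∨ b < c) :
    0 < signedArea (circlePoint n a) (circlePoint n b) (circlePoint n c) := by
  rw [signedArea_circlePoint]
  have h1 := sin_index_pos hab
  rcases h with h | h
  · have h2 := sin_index_neg h
    have h3 := sin_index_neg (h.trans hab)
    exact mul_pos_of_neg_of_neg (mul_neg_of_pos_of_neg (by positivity) h3) h2
  · have h2 := sin_index_pos h
    have h3 := sin_index_pos (hab.trans h)
    positivity

theorem disjoint_segment_of_signedArea {x y z w : ℂ}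
    (h : 0 < signedArea x y z * signedArea x y w) : Disjoint (segment ℝ x y) (segment ℝ z w) := by
  rw [Set.disjoint_left]
  rintro _ ⟨s, t, hs, ht, hst, rfl⟩ ⟨u, v, hu, hv, huv, e⟩
  have e1 := congrArg Complex.re e
  have e2 := congrArg Complex.im e
  simp at e1 e2
  have key : u * signedArea x y z + v * signedArea x y w = 0 := by
    obtain rfl : s = 1 - t := by linarith
    obtain rfl : u = 1 - v := by linarith
    unfold signedArea
    linear_combination (y.re - x.re) * e2 - (y.im - x.im) * e1
  rcases pos_and_pos_or_neg_and_neg_of_mul_pos h with ⟨h1, h2⟩ | ⟨h1, h2⟩ <;>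
    rcases hu.eq_or_lt with rfl | hu' <;> nlinarith

theorem not_disjoint_segment_of_signedArea {x y z w : ℂ}
    (h1 : signedArea x y z < 0) (h2 : 0 < signedArea x y w)
    (h3 : 0 < signedArea z w x) (h4 : signedArea z w y < 0) :
    ¬ Disjoint (segment ℝ x y) (segment ℝ z w) := by
  rw [Set.not_disjoint_iff]
  have hE : 0 < signedArea x y w - signedArea x y z := by linarith
  have hE' : signedArea x y w - signedArea x y z = signedArea z w x - signedArea z w y := by
    unfold signedArea; ring
  refine ⟨(-signedArea z w y / (signedArea x y w - signedArea x y z)) • x +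
      (signedArea z w x / (signedArea x y w - signedArea x y z)) • y, ⟨_, _, ?_, ?_, ?_, rfl⟩,
    ⟨signedArea x y w / (signedArea x y w - signedArea x y z),
      -signedArea x y z / (signedArea x y w - signedArea x y z), ?_, ?_, ?_, ?_⟩⟩
  · exact div_nonneg (by linarith) hE.le
  · exact div_nonneg (by linarith) hE.le
  · rw [← add_div, div_eq_one_iff_eq hE.ne', hE']; ring
  · exact div_nonneg (by linarith) hE.le
  · exact div_nonneg (by linarith) hE.le
  · rw [← add_div, div_eq_one_iff_eq hE.ne']; ring
  · apply Complex.ext <;>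
    simp only [Complex.add_re, Complex.add_im, Complex.smul_re, Complex.smul_im, smul_eq_mul] <;>
    field_simp <;> unfold signedArea <;> ring

/-- Chords without a common endpoint are disjoint if and only if their endpoints do not
alternate around the circle. -/
theorem disjoint_chord_iff {n : ℕ} {a b c d : Fin (2 * n)} (hab : a < b) (hcd : c < d)
    (hac : a ≠ c) (had : a ≠ d) (hbc : b ≠ c) (hbd : b ≠ d) :
    Disjoint (chord n s(a, b)) (chord n s(c, d)) ↔
      ¬ (a < c ∧ c < b ∧ b < d) ∧ ¬ (c < a ∧ a < d ∧ d < b) := by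
  rw [chord_mk, chord_mk]
  constructor
  · intro h
    refine ⟨fun ⟨h1, h2, h3⟩ => ?_, fun ⟨h1, h2, h3⟩ => ?_⟩
    · exact not_disjoint_segment_of_signedArea (signedArea_neg_of_between h1 h2)
        (signedArea_pos_of_outside hab (.inr h3)) (signedArea_pos_of_outside hcd (.inl h1))
        (signedArea_neg_of_between h2 h3) h
    · exact not_disjoint_segment_of_signedArea (signedArea_neg_of_between h1 h2)
        (signedArea_pos_of_outside hcd (.inr h3)) (signedArea_pos_of_outside hab (.inl h1))
        (signedArea_neg_of_between h2 h3) h.symm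
  · rintro ⟨h1, h2⟩
    apply disjoint_segment_of_signedArea
    have h : (a < c ∧ c < b) ∧ (a < d ∧ d < b) ∨ (c < a ∨ b < c) ∧ (d < a ∨ b < d) := by
      simp only [Fin.lt_def, ne_eq, Fin.ext_iff] at *
      omega
    rcases h with ⟨⟨p, q⟩, r, s⟩ | ⟨p, q⟩
    · exact mul_pos_of_neg_of_neg (signedArea_neg_of_between p q) (signedArea_neg_of_between r s)
    · exact mul_pos (signedArea_pos_of_outside hab p) (signedArea_pos_of_outside hab q)

/-! Weigh a chord by twice its shorter arc length minus `n`. The arcs cut off by the sides of a flip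
quadrilateral sum to `2n`, so the four weights sum to at most `0`, with equality exactly when no
shorter arc differs from the arc cut off, that is, when the quadrilateral contains the centre
(`IsFlip.addedSum_lengthWeight_le`). Over a closed walk every edge is gained as often as it is lost,
so along an `r`-rainbow cycle these sums total `2r` times the weight of all possible edges. That
weight is `n` for odd `n` and `0` for even `n` (`sum_lengthWeight`): odd `n` is impossible, and for
even `n` every flip is centred.

Let `n` be even. Colour the regions cut out by a matching alternately, with the region at the arc
from point `2n - 1` to point `0` black. The chords spanning more than `n` points separate that
region from the centre and have alternating signs, so `longSign` sums to `0` or `1` according to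
whether the centre is black or white; `oddStart` sums to the number of black regions minus one. A
centred flip switches the colour of the centre and preserves `oddStart - longSign`
(`IsFlip.valueSum_eq_and_add_eq_one`). Hence half of the vertices of the cycle have a black centre
and a common number of black regions. As each flip adds two of the `n ^ 2` possible edges, the cycle
has length `r * n ^ 2 / 2`, so there are `r * n ^ 2 / 4` such vertices.

It remains to count these matchings, coded as binary trees. Generating functions give `1 / (n + 1) *
choose (n + 1) b * choose (n - 2) (b - 1)` for `b` black regions and a black centre
(`coeff_blackPoly_sub_longPoly`). This is largest at `b = n / 2`, where it is half of `N_1(n, n /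
2)`. -/

/-! ### Generating functions of black regions and long chords -/

section TreeCounting

open BinaryTree Finset Polynomial

/-- The number of regions of colour black in the region tree coded by a binary tree whose
base region is black if and only if `c` is true. -/
def blackCount : Bool → BinaryTree Unit → ℕ
  | c, .nil => if c then 1 else 0
  | c, .node _ l r => blackCount (!c) l + blackCount c r

/-- The colour of a chord, as a sign. -/
def boolSign (c : Bool) : ℤ := if c then 1 else -1

theorem boolSign_not (c : Bool) : boolSign (!c) = -boolSign c := by cases c <;> rfl

/-- The signed number of chords that span more than `n` points; a chord counts positively if
the region around it is black. -/
def longCount (n : ℕ) : Bool → BinaryTree Unit → ℤ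
  | _, .nil => 0
  | c, .node _ l r =>
    (if n < 2 * l.numNodes + 1 then boolSign c else 0) + longCount n (!c) l + longCount n c r

theorem longCount_eq_zero {n : ℕ} (c : Bool) (t : BinaryTree Unit)
    (h : 2 * t.numNodes < n + 1) : longCount n c t = 0 := by
  induction t generalizing c with
  | nil => rfl
  | node _ l r hl hr =>
    rw [numNodes] at h
    rw [longCount, hl _ (by omega), hr _ (by omega), if_neg (by omega)]
    rfl

/-- With at most `n` chords, two long chords cannot lie side by side, and a chord around a long one
is itself long. So the long chords form a chain, each directly inside the previous one, and their
signs alternate from `boolSign c` on. -/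
theorem longCount_eq_zero_or {n : ℕ} (c : Bool) (t : BinaryTree Unit)
    (h : t.numNodes ≤ n) : longCount n c t = 0 ∨ longCount n c t = boolSign c := by
  induction t generalizing c with
  | nil => exact .inl rfl
  | node _ l r hl hr =>
    rw [numNodes] at h
    rw [longCount]
    split_ifs with h1
    · rw [longCount_eq_zero c r (by omega)]
      rcases hl (!c) (by omega) with h2 | h2
      · rw [h2]; simp
      · rw [h2, boolSign_not]; simp
    · rw [longCount_eq_zero (!c) l (by omega)]
      simpa using hr c (by omega)

theorem sum_treesOfNumNodesEq_succ {A : Type*} [AddCommMonoid A] (m : ℕ)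
    (F : BinaryTree Unit → A) :
    ∑ t ∈ treesOfNumNodesEq (m + 1), F t = ∑ ij ∈ antidiagonal m,
      ∑ l ∈ treesOfNumNodesEq ij.1, ∑ r ∈ treesOfNumNodesEq ij.2, F (.node () l r) := by
  rw [treesOfNumNodesEq_succ, sum_biUnion]
  · refine sum_congr rfl fun ij _ => ?_
    rw [← sum_product', pairwiseNode, sum_map]
    rfl
  · intro x _ y _ hxy
    rw [Function.onFun, disjoint_left]
    intro t hx hy
    rw [pairwiseNode, mem_map] at hx hy
    obtain ⟨⟨a, b⟩, hab, rfl⟩ := hx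
    obtain ⟨⟨a', b'⟩, hab', h⟩ := hy
    obtain ⟨rfl, rfl⟩ : a' = a ∧ b' = b := by simpa using h
    simp only [mem_product, mem_treesOfNumNodesEq] at hab hab'
    apply hxy
    ext
    · rw [← hab.1, ← hab'.1]
    · rw [← hab.2, ← hab'.2]

/-- The generating polynomial of the black regions over trees with `m` nodes. -/
noncomputable def blackPoly (c : Bool) (m : ℕ) : ℚ[X] :=
  ∑ t ∈ treesOfNumNodesEq m, X ^ blackCount c t

/-- The generating polynomial of the black regions over trees with `m` nodes, weighted by the
signed number of long chords. -/
noncomputable def longPoly (n : ℕ) (c : Bool) (m : ℕ) : ℚ[X] :=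
  ∑ t ∈ treesOfNumNodesEq m, (longCount n c t : ℚ[X]) * X ^ blackCount c t

theorem blackPoly_zero (c : Bool) : blackPoly c 0 = if c then X else 1 := by
  cases c <;> simp [blackPoly, blackCount]

theorem longPoly_zero (n : ℕ) (c : Bool) : longPoly n c 0 = 0 := by
  simp [longPoly, longCount]

theorem blackPoly_succ (c : Bool) (m : ℕ) :
    blackPoly c (m + 1) = ∑ ij ∈ antidiagonal m, blackPoly (!c) ij.1 * blackPoly c ij.2 := by
  rw [blackPoly, sum_treesOfNumNodesEq_succ]
  refine sum_congr rfl fun ij _ => ?_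
  rw [blackPoly, blackPoly, sum_mul_sum]
  simp only [blackCount, pow_add]

theorem longPoly_succ (n : ℕ) (c : Bool) (m : ℕ) :
    longPoly n c (m + 1) = ∑ ij ∈ antidiagonal m,
      ((if n < 2 * ij.1 + 1 then (boolSign c : ℚ[X]) else 0) * blackPoly (!c) ij.1
          * blackPoly c ij.2
        + longPoly n (!c) ij.1 * blackPoly c ij.2 + blackPoly (!c) ij.1 * longPoly n c ij.2) := by
  rw [longPoly, sum_treesOfNumNodesEq_succ]
  refine sum_congr rfl fun ij _ => ?_
  rw [mul_assoc]
  simp only [blackPoly, longPoly, sum_mul_sum]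
  rw [mul_sum]
  simp only [mul_sum, ← sum_add_distrib]
  refine sum_congr rfl fun l hl => sum_congr rfl fun r _ => ?_
  rw [mem_treesOfNumNodesEq] at hl
  rw [longCount, blackCount, hl]
  push_cast
  split_ifs <;> ring

/-- Swapping the two subtrees at the root exchanges the colours in the recurrence, so the base
colour matters only for the empty tree. -/
theorem blackPoly_true (m : ℕ) :
    blackPoly true m = blackPoly false m + if m = 0 then X - 1 else 0 := by
  cases m with
  | zero => simp [blackPoly_zero]
  | succ m =>
    rw [blackPoly_succ, blackPoly_succ, ← Nat.sum_antidiagonal_swap]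
    simp [mul_comm]

/-- The power series with coefficients `blackPoly c`. -/
noncomputable def blackSeries (c : Bool) : PowerSeries ℚ[X] := PowerSeries.mk (blackPoly c)

/-- The power series with coefficients `longPoly n c`. -/
noncomputable def longSeries (n : ℕ) (c : Bool) : PowerSeries ℚ[X] :=
  PowerSeries.mk (longPoly n c)

/-- The part of the series `blackSeries` that corresponds to the inside of long chords. -/
noncomputable def longPart (n : ℕ) : PowerSeries ℚ[X] :=
  PowerSeries.mk fun i => if n < 2 * i + 1 then blackPoly true i else 0

theorem blackSeries_eq (c : Bool) :
    blackSeries c = PowerSeries.C (blackPoly c 0)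
      + PowerSeries.X * (blackSeries (!c) * blackSeries c) := by
  ext1 m
  cases m with
  | zero => simp [blackSeries]
  | succ m =>
    rw [map_add, PowerSeries.coeff_succ_X_mul, PowerSeries.coeff_mul, PowerSeries.coeff_C,
      if_neg m.succ_ne_zero, zero_add]
    simp only [blackSeries, PowerSeries.coeff_mk, blackPoly_succ]

theorem ite_blackPoly {n : ℕ} (hn : 1 ≤ n) (c : Bool) (i : ℕ) :
    (if n < 2 * i + 1 then blackPoly c i else 0)
      = if n < 2 * i + 1 then blackPoly true i else 0 := by
  split_ifs with h
  · cases c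
    · rw [blackPoly_true, if_neg (by omega), add_zero]
    · rfl
  · rfl

theorem longSeries_eq_rec {n : ℕ} (hn : 1 ≤ n) (c : Bool) :
    longSeries n c = PowerSeries.X *
      ((boolSign c : PowerSeries ℚ[X]) * (longPart n * blackSeries c)
        + longSeries n (!c) * blackSeries c + blackSeries (!c) * longSeries n c) := by
  ext1 m
  cases m with
  | zero => simp [longSeries, longPoly_zero]
  | succ m =>
    have e : (boolSign c : PowerSeries ℚ[X]) = PowerSeries.C (boolSign c : ℚ[X]) := by simp
    rw [PowerSeries.coeff_succ_X_mul, e, map_add, map_add, PowerSeries.coeff_C_mul,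
      PowerSeries.coeff_mul, PowerSeries.coeff_mul, PowerSeries.coeff_mul, longSeries,
      PowerSeries.coeff_mk, longPoly_succ, mul_sum, ← sum_add_distrib, ← sum_add_distrib]
    refine sum_congr rfl fun ij _ => ?_
    simp only [blackSeries, longSeries, longPart, PowerSeries.coeff_mk]
    rw [← ite_blackPoly hn (!c)]
    split_ifs <;> ring

/-- In the linear system `longSeries_eq_rec` the right-hand side proposed here makes the two
recursive terms cancel, by the opposite signs of the two colours. The proof is uniqueness: the
differences `U` and `V` solve the homogeneous system, which forces them to vanish. -/
theorem longSeries_eq {n : ℕ} (hn : 1 ≤ n) (c : Bool) :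
    longSeries n c = (boolSign c : PowerSeries ℚ[X]) *
      (PowerSeries.X * (longPart n * blackSeries c)) := by
  have h1 := blackSeries_eq true
  have h2 := blackSeries_eq false
  have h3 := longSeries_eq_rec hn true
  have h4 := longSeries_eq_rec hn false
  simp only [Bool.not_true, Bool.not_false, boolSign, if_true, Bool.false_eq_true, if_false,
    Int.cast_one, Int.cast_neg, one_mul, neg_mul, blackPoly_zero, map_one] at h1 h2 h3 h4
  set P := blackSeries true
  set Q := blackSeries false
  set U := longSeries n true - PowerSeries.X * (longPart n * P) with hU
  set V := longSeries n false + PowerSeries.X * (longPart n * Q) with hV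
  set x : PowerSeries ℚ[X] := PowerSeries.X
  have e1 : U = x * (V * P + Q * U) := by rw [hU, hV]; linear_combination h3
  have e2 : V = x * (U * Q + P * V) := by rw [hU, hV]; linear_combination h4
  -- Multiplying by `P` (below, by `Q`) lets the quadratic equation for the series absorb the
  -- diagonal term.
  have e3 : U * PowerSeries.C X = x * V * P ^ 2 := by linear_combination P * e1 - U * h1
  have e4 : V = x * U * Q ^ 2 := by linear_combination Q * e2 - V * h2
  have hU0 : U = 0 := by
    have : U * (PowerSeries.C X - x ^ 2 * Q ^ 2 * P ^ 2) = 0 := by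
      linear_combination e3 + x * P ^ 2 * e4
    rcases mul_eq_zero.1 this with h | h
    · exact h
    -- The other factor has constant coefficient `X`, so it is not zero.
    · have := congrArg PowerSeries.constantCoeff h
      simp [x] at this
  have hV0 : V = 0 := by rw [e4, hU0]; ring
  cases c
  · simp only [boolSign, Bool.false_eq_true, if_false, Int.cast_neg, Int.cast_one]
    linear_combination hV0
  · simp only [boolSign, if_true, Int.cast_one]
    linear_combination hU0

theorem longPoly_true_succ {n : ℕ} (hn : 1 ≤ n) (m : ℕ) :
    longPoly n true (m + 1) = ∑ ij ∈ antidiagonal m,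
      if n < 2 * ij.1 + 1 then blackPoly true ij.1 * blackPoly true ij.2 else 0 := by
  have := congrArg (PowerSeries.coeff (m + 1)) (longSeries_eq hn true)
  rw [boolSign, if_pos rfl, Int.cast_one, one_mul, PowerSeries.coeff_succ_X_mul,
    PowerSeries.coeff_mul] at this
  simp only [longSeries, longPart, blackSeries, PowerSeries.coeff_mk] at this
  rw [this]
  simp only [ite_mul, zero_mul]

/-- In the recurrence for `blackPoly true n` exactly one of the two parts at the root is long. The
terms with a long first part make up `longPoly`, and the other terms, after a swap, differ from it
only by the colour of an empty tree. -/
theorem two_mul_longPoly {n : ℕ} (hn : 2 ≤ n) (he : Even n) :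
    2 * longPoly n true n = blackPoly true n + (X - 1) * blackPoly true (n - 1) := by
  obtain ⟨m, rfl⟩ : ∃ m, n = m + 1 := ⟨n - 1, by omega⟩
  -- The odd numbers `2 * ij.1 + 1` and `2 * ij.2 + 1` sum to twice the even number `m + 1`, so
  -- neither equals it and exactly one exceeds it.
  have key (ij : ℕ × ℕ) (h : ij ∈ antidiagonal m) :
      ¬ (m + 1 < 2 * ij.1 + 1) ↔ m + 1 < 2 * ij.2 + 1 := by
    rw [HasAntidiagonal.mem_antidiagonal] at h
    obtain ⟨k, hk⟩ := he
    omega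
  have hsplit : blackPoly true (m + 1) = longPoly (m + 1) true (m + 1)
      + ∑ ij ∈ antidiagonal m, if m + 1 < 2 * ij.1 + 1 then
        blackPoly false ij.2 * blackPoly true ij.1 else 0 := by
    rw [blackPoly_succ, longPoly_true_succ (by omega),
      ← Nat.sum_antidiagonal_swap (f := fun ij : ℕ × ℕ => if m + 1 < 2 * ij.1 + 1 then
        blackPoly false ij.2 * blackPoly true ij.1 else 0), ← sum_add_distrib]
    refine sum_congr rfl fun ij hij => ?_
    have := key ij hij
    by_cases h : m + 1 < 2 * ij.1 + 1
    · have h0 : ij.1 ≠ 0 := by omega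
      simp only [Prod.fst_swap, Prod.snd_swap, h, if_true, ← this, not_true, if_false, add_zero]
      rw [blackPoly_true ij.1, if_neg h0]
      simp
    · simp only [Prod.fst_swap, Prod.snd_swap, h, if_false, ← this, not_false_eq_true, if_true,
        zero_add, Bool.not_true]
  have hdiff : longPoly (m + 1) true (m + 1) - (∑ ij ∈ antidiagonal m,
      if m + 1 < 2 * ij.1 + 1 then blackPoly false ij.2 * blackPoly true ij.1 else 0)
      = (X - 1) * blackPoly true m := by
    rw [longPoly_true_succ (by omega), ← sum_sub_distrib, sum_eq_single (m, 0)]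
    · rw [if_pos (by omega), if_pos (by omega), blackPoly_zero, blackPoly_zero]
      simp
      ring
    · intro ij hij hne
      rw [HasAntidiagonal.mem_antidiagonal] at hij
      have h0 : ij.2 ≠ 0 := fun h => hne (by ext <;> simp <;> omega)
      rw [blackPoly_true ij.2, if_neg h0]
      split_ifs <;> ring
    · simp
  rw [Nat.add_sub_cancel]
  linear_combination hdiff - hsplit

end TreeCounting

/-! ### Coefficients: Narayana numbers -/

section NarayanaNumbers

open BinaryTree Finset Polynomial

/-- The series is algebraic of degree two, so the square root `R` of its discriminant satisfies a
first-order linear differential equation. Comparing coefficients gives the three-term recurrence. -/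
theorem blackPoly_recurrence (k : ℕ) :
    ((k : ℚ[X]) + 3) * blackPoly false (k + 2) =
      (2 * (k : ℚ[X]) + 3) * ((1 + X) * blackPoly false (k + 1))
        - (k : ℚ[X]) * ((1 - X) ^ 2 * blackPoly false k) := by
  have h1 := blackSeries_eq true
  have h2 := blackSeries_eq false
  simp only [Bool.not_true, Bool.not_false, Bool.false_eq_true, if_true, if_false,
    blackPoly_zero, map_one] at h1 h2
  set Q := blackSeries false with hQ
  set x : PowerSeries ℚ[X] := PowerSeries.X with hx
  set t : PowerSeries ℚ[X] := PowerSeries.C X with ht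
  have hP : blackSeries true = Q + t - 1 := by linear_combination h1 - h2
  rw [hP] at h2
  set R := 1 - x * (t - 1) - 2 * x * Q with hR
  have hsq : R ^ 2 = (1 - x * (t - 1)) ^ 2 - 4 * x := by
    rw [hR]; linear_combination (-4 * x) * h2
  have hd := congrArg (PowerSeries.derivative ℚ[X]) hsq
  have hdt : PowerSeries.derivative ℚ[X] t = 0 := PowerSeries.derivative_C
  have hdx : PowerSeries.derivative ℚ[X] x = 1 := PowerSeries.derivative_X
  have h4 : PowerSeries.derivative ℚ[X] (4 : PowerSeries ℚ[X]) = 0 := by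
    rw [← map_ofNat (PowerSeries.C (R := ℚ[X])) 4, PowerSeries.derivative_C]
  simp only [pow_two, map_sub, Derivation.leibniz, Derivation.map_one_eq_zero, hdt, hdx, h4,
    smul_eq_mul] at hd
  set R' := PowerSeries.derivative ℚ[X] R with hR'
  have hode : R' - x * ((2 + 2 * t) * R') + x * (x * ((1 - t) ^ 2 * R'))
      = -((1 + t) * R) + x * ((1 - t) ^ 2 * R) := by
    have h2' : (2 : PowerSeries ℚ[X]) * (R' - x * ((2 + 2 * t) * R') + x * (x * ((1 - t) ^ 2 * R'))
      - (-((1 + t) * R) + x * ((1 - t) ^ 2 * R))) = 0 := by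
      linear_combination (-2 * R') * hsq + R * hd
    have := (mul_eq_zero.1 h2').resolve_left fun h => by
      have := congrArg PowerSeries.constantCoeff h
      rw [map_ofNat, map_zero] at this
      exact two_ne_zero this
    linear_combination this
  have e1 : (2 + 2 * t : PowerSeries ℚ[X]) = PowerSeries.C (2 + 2 * X : ℚ[X]) := by
    rw [map_add, map_mul, map_ofNat, ht]
  have e2 : ((1 - t) ^ 2 : PowerSeries ℚ[X]) = PowerSeries.C ((1 - X) ^ 2 : ℚ[X]) := by simp [ht]
  have e3 : (1 + t : PowerSeries ℚ[X]) = PowerSeries.C (1 + X : ℚ[X]) := by simp [ht]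
  have hr (m : ℕ) : PowerSeries.coeff (m + 2) R = -2 * blackPoly false (m + 1) := by
    have e : R = 1 - x * PowerSeries.C (X - 1 : ℚ[X]) - x * (PowerSeries.C 2 * Q) := by
      rw [hR, ht, map_sub, map_one, map_ofNat]; ring
    rw [e, map_sub, map_sub, hx, PowerSeries.coeff_succ_X_mul, PowerSeries.coeff_succ_X_mul,
      PowerSeries.coeff_C_mul, PowerSeries.coeff_C, PowerSeries.coeff_one, if_neg (by omega),
      if_neg (by omega), hQ, blackSeries, PowerSeries.coeff_mk]
    ring
  -- For `k = 0` the coefficient of `R` does not have the form in `hr`; the factor `k` hides this.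
  have hr1 : (k : ℚ[X]) * PowerSeries.coeff (k + 1) R = -2 * (k * blackPoly false k) := by
    cases k with
    | zero => simp
    | succ k => rw [hr]; ring
  have hc := congrArg (PowerSeries.coeff (k + 2)) hode
  rw [e1, e2, e3] at hc
  generalize hu1 : (2 + 2 * X : ℚ[X]) = u1, hu2 : ((1 - X) ^ 2 : ℚ[X]) = u2,
    hu3 : (1 + X : ℚ[X]) = u3 at hc
  rw [map_add, map_sub, map_add, map_neg, hx, PowerSeries.coeff_succ_X_mul,
    PowerSeries.coeff_succ_X_mul, PowerSeries.coeff_succ_X_mul, PowerSeries.coeff_succ_X_mul,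
    PowerSeries.coeff_C_mul, PowerSeries.coeff_C_mul, PowerSeries.coeff_C_mul,
    PowerSeries.coeff_C_mul, hR', PowerSeries.coeff_derivative, PowerSeries.coeff_derivative,
    PowerSeries.coeff_derivative, hr, hr] at hc
  subst hu1 hu2 hu3
  push_cast at hc
  have : (-2 : ℚ[X]) * (((k : ℚ[X]) + 3) * blackPoly false (k + 2) -
      ((2 * (k : ℚ[X]) + 3) * ((1 + X) * blackPoly false (k + 1))
        - (k : ℚ[X]) * ((1 - X) ^ 2 * blackPoly false k))) = 0 := by
    linear_combination hc - (1 - X) ^ 2 * hr1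
  have := (mul_eq_zero.1 this).resolve_left (by norm_num)
  linear_combination this

/-- The reciprocal of the factorial, extended by `0` to the negative integers. -/
def invFactorial (k : ℤ) : ℚ := if 0 ≤ k then 1 / (k.toNat.factorial : ℚ) else 0

theorem invFactorial_natCast (k : ℕ) : invFactorial k = 1 / (k.factorial : ℚ) := by
  simp [invFactorial]

theorem invFactorial_of_neg {k : ℤ} (h : k < 0) : invFactorial k = 0 := by
  rw [invFactorial, if_neg (by omega)]

/-- Valid for all integers, also at `0`, where both sides vanish. Narayana identities thereby become
polynomial identities without boundary cases. -/
theorem invFactorial_sub_one (k : ℤ) : invFactorial (k - 1) = k * invFactorial k := by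
  rcases lt_trichotomy k 0 with h | rfl | h
  · rw [invFactorial_of_neg h, invFactorial_of_neg (by omega), mul_zero]
  · rw [invFactorial_of_neg (by omega)]; simp
  · obtain ⟨m, rfl⟩ : ∃ m : ℕ, k = m + 1 := ⟨(k - 1).toNat, by omega⟩
    rw [add_sub_cancel_right, invFactorial_natCast, ← Nat.cast_succ, invFactorial_natCast,
      Nat.factorial_succ]
    have : (m.factorial : ℚ) ≠ 0 := by positivity
    push_cast
    field_simp

theorem choose_eq_invFactorial (m k : ℕ) :
    (m.choose k : ℚ) = m.factorial * invFactorial k * invFactorial ((m : ℤ) - k) := by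
  rcases le_or_gt k m with h | h
  · rw [Nat.cast_choose ℚ h, ← Nat.cast_sub h, invFactorial_natCast, invFactorial_natCast]
    field_simp
  · rw [Nat.choose_eq_zero_of_lt h, invFactorial_of_neg (k := (m : ℤ) - k) (by omega)]
    simp

/-- The Narayana number `(1 / m) * choose m b * choose m (b - 1)`, for `m ≥ 1`. -/
def narayanaNumber (m : ℕ) (b : ℤ) : ℚ :=
  m.factorial * (m - 1).factorial * invFactorial b * invFactorial (b - 1) * invFactorial (m - b)
    * invFactorial (m - b + 1)

theorem narayanaNumber_of_nonpos (m : ℕ) {b : ℤ} (h : b ≤ 0) : narayanaNumber m b = 0 := by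
  rw [narayanaNumber, invFactorial_of_neg (k := b - 1) (by omega)]
  simp

theorem narayanaNumber_recurrence {k : ℕ} (hk : 1 ≤ k) (b : ℤ) :
    ((k : ℚ) + 3) * narayanaNumber (k + 2) b =
      (2 * k + 3) * (narayanaNumber (k + 1) b + narayanaNumber (k + 1) (b - 1))
        - k * (narayanaNumber k b - 2 * narayanaNumber k (b - 1) + narayanaNumber k (b - 2)) := by
  obtain ⟨j, rfl⟩ : ∃ j, k = j + 1 := ⟨k - 1, by omega⟩
  have h1 := invFactorial_sub_one b
  have h2 := invFactorial_sub_one (b - 1)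
  have h3 := invFactorial_sub_one (b - 2)
  have g1 := invFactorial_sub_one (j + 4 - b)
  have g2 := invFactorial_sub_one (j + 3 - b)
  have g3 := invFactorial_sub_one (j + 2 - b)
  have a1 : (b - 1 - 1 : ℤ) = b - 2 := by ring
  have a2 : (b - 2 - 1 : ℤ) = b - 3 := by ring
  have a3 : (j + 4 - b - 1 : ℤ) = j + 3 - b := by ring
  have a4 : (j + 3 - b - 1 : ℤ) = j + 2 - b := by ring
  have a5 : (j + 2 - b - 1 : ℤ) = j + 1 - b := by ring
  rw [a1] at h2
  rw [a2] at h3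
  rw [a3] at g1
  rw [a4] at g2
  rw [a5] at g3
  unfold narayanaNumber
  have c1 : (((j + 1 + 2 : ℕ) : ℤ) - b) = j + 3 - b := by push_cast; ring
  have c2 : ((j : ℤ) + 3 - b + 1) = j + 4 - b := by ring
  have c3 : (((j + 1 + 1 : ℕ) : ℤ) - b) = j + 2 - b := by push_cast; ring
  have c4 : ((j : ℤ) + 2 - b + 1) = j + 3 - b := by ring
  have c5 : (((j + 1 + 1 : ℕ) : ℤ) - (b - 1)) = j + 3 - b := by push_cast; ring
  have c6 : (((j + 1 : ℕ) : ℤ) - b) = j + 1 - b := by push_cast; ring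
  have c7 : ((j : ℤ) + 1 - b + 1) = j + 2 - b := by ring
  have c8 : (((j + 1 : ℕ) : ℤ) - (b - 1)) = j + 2 - b := by push_cast; ring
  have c9 : (((j + 1 : ℕ) : ℤ) - (b - 2)) = j + 3 - b := by push_cast; ring
  -- Every reciprocal factorial becomes a polynomial multiple of `invFactorial b` or `invFactorial
  -- (j + 4 - b)`.
  rw [c1, c2, c3, c4, c5, c6, c7, c8, c9, c2, c4, a1, a2, h3, h2, h1, g3, g2, g1]
  have f1 : (j + 1 + 2 - 1 : ℕ) = j + 2 := by omega
  have f2 : (j + 1 + 1 - 1 : ℕ) = j + 1 := by omega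
  have f3 : (j + 1 - 1 : ℕ) = j := by omega
  rw [f1, f2, f3, show j + 1 + 2 = j + 3 by ring, show j + 1 + 1 = j + 2 by ring,
    Nat.factorial_succ (j + 2), Nat.factorial_succ (j + 1), Nat.factorial_succ j]
  push_cast
  ring

theorem coeff_blackPoly_false {m : ℕ} (hm : 1 ≤ m) (b : ℕ) :
    (blackPoly false m).coeff b = narayanaNumber m b := by
  have base (b : ℕ) : (blackPoly false 1).coeff b = narayanaNumber 1 b := by
    rw [blackPoly_succ]
    simp only [Finset.HasAntidiagonal.antidiagonal_zero, sum_singleton, blackPoly_zero, Bool.not_false, if_true,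
      Bool.false_eq_true, if_false, mul_one, coeff_X, narayanaNumber]
    obtain rfl | rfl | hb : b = 0 ∨ b = 1 ∨ 2 ≤ b := by omega
    · simp [invFactorial]
    · simp [invFactorial]
    · rw [if_neg (by omega), invFactorial_of_neg (k := ((1 : ℕ) : ℤ) - b) (by omega)]
      simp
  induction m using Nat.strong_induction_on generalizing b with
  | _ m ih =>
    obtain rfl | ⟨k, rfl⟩ : m = 1 ∨ ∃ k, m = k + 2 := by
      rcases Nat.lt_or_ge m 2 with h | h
      · exact .inl (by omega)
      · exact .inr ⟨m - 2, by omega⟩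
    · exact base b
    · have h1 := ih (k + 1) (by omega) (by omega)
      have hX (p : ℚ[X]) (f : ℤ → ℚ) (hf : ∀ b : ℤ, b < 0 → f b = 0)
          (h : ∀ b : ℕ, p.coeff b = f b) (b : ℕ) : (X * p).coeff b = f (b - 1) := by
        cases b with
        | zero => rw [coeff_X_mul_zero, hf _ (by simp)]
        | succ b => rw [coeff_X_mul, h]; congr 1; push_cast; ring
      have hN (m : ℕ) (j : ℤ) (hj : 0 ≤ j) (b : ℤ) (hb : b < 0) :
          narayanaNumber m (b - j) = 0 := narayanaNumber_of_nonpos m (by omega)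
      have h1X := hX _ (narayanaNumber (k + 1)) (by simpa using hN (k + 1) 0 le_rfl) h1
      have key : ((k : ℚ) + 3) * (blackPoly false (k + 2)).coeff b
          = (k + 3) * narayanaNumber (k + 2) b := by
        have hrec := congrArg (coeff · b) (blackPoly_recurrence k)
        have l1 : ((k : ℚ[X]) + 3) = C ((k : ℚ) + 3) := by
          rw [map_add, map_natCast, map_ofNat]
        have l2 : ((2 : ℚ[X]) * k + 3) = C (2 * (k : ℚ) + 3) := by
          rw [map_add, map_mul, map_natCast, map_ofNat, map_ofNat]
        have l3 : (k : ℚ[X]) = C (k : ℚ) := by simp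
        have l4 : ((1 - X) ^ 2 * blackPoly false k : ℚ[X]) = blackPoly false k
            - C 2 * (X * blackPoly false k) + X * (X * blackPoly false k) := by
          rw [map_ofNat]; ring
        rw [l1, l2, l4, l3, add_mul 1 X, one_mul] at hrec
        simp only [coeff_C_mul, coeff_sub, coeff_add, h1, h1X] at hrec
        rw [hrec]
        -- The recurrence of `narayanaNumber` starts at `k = 1`. At `k = 0` the last term drops out
        -- and the few nonzero coefficients are checked directly.
        rcases Nat.eq_zero_or_pos k with rfl | hk
        · obtain rfl | rfl | rfl | hb : b = 0 ∨ b = 1 ∨ b = 2 ∨ 3 ≤ b := by omega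
          · simp [narayanaNumber, invFactorial]
          · simp [narayanaNumber, invFactorial]
          · simp [narayanaNumber, invFactorial]
          · simp only [narayanaNumber]
            rw [invFactorial_of_neg (k := ((0 + 1 : ℕ) : ℤ) - b) (by omega),
              invFactorial_of_neg (k := ((0 + 1 : ℕ) : ℤ) - (b - 1)) (by omega),
              invFactorial_of_neg (k := ((0 + 2 : ℕ) : ℤ) - b) (by omega)]
            simp
        · have h0 := ih k (by omega) hk
          have h0X := hX _ (narayanaNumber k) (by simpa using hN k 0 le_rfl) h0
          have h0XX := hX _ (fun b => narayanaNumber k (b - 1)) (hN k 1 (by simp)) h0X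
          rw [h0, h0X, h0XX, narayanaNumber_recurrence hk, show (b : ℤ) - 1 - 1 = b - 2 by ring]
      exact mul_left_cancel₀ (by positivity) key

theorem coeff_blackPoly_sub_longPoly {n : ℕ} (hn : 2 ≤ n) (he : Even n) (k : ℕ) :
    (blackPoly true n - longPoly n true n).coeff (k + 1)
      = 1 / ((n : ℚ) + 1) * (n + 1).choose (k + 1) * (n - 2).choose k := by
  obtain ⟨m, rfl⟩ : ∃ m, n = m + 2 := ⟨n - 2, by omega⟩
  have h := two_mul_longPoly hn he
  have e (j : ℕ) : blackPoly true (j + 1) = blackPoly false (j + 1) := by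
    rw [blackPoly_true, if_neg (by omega), add_zero]
  rw [show m + 2 - 1 = m + 1 by omega, e, e] at h
  have h2 : C 2 * (blackPoly true (m + 2) - longPoly (m + 2) true (m + 2))
      = blackPoly false (m + 2) + blackPoly false (m + 1) - X * blackPoly false (m + 1) := by
    rw [e]
    rw [map_ofNat]
    linear_combination -h
  have h3 := congrArg (coeff · (k + 1)) h2
  simp only [coeff_C_mul, coeff_sub, coeff_add, coeff_X_mul] at h3
  rw [coeff_blackPoly_false (by omega), coeff_blackPoly_false (by omega),
    coeff_blackPoly_false (by omega)] at h3
  have key : narayanaNumber (m + 2) ((k + 1 : ℕ) : ℤ) + narayanaNumber (m + 1) ((k + 1 : ℕ) : ℤ)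
      - narayanaNumber (m + 1) k
      = 2 * (1 / (((m + 2 : ℕ) : ℚ) + 1) * (m + 2 + 1).choose (k + 1) * (m + 2 - 2).choose k) := by
    rw [choose_eq_invFactorial, choose_eq_invFactorial]
    unfold narayanaNumber
    have g1 := invFactorial_sub_one (k + 1)
    have g2 := invFactorial_sub_one k
    have g3 := invFactorial_sub_one (m + 2 - k)
    have g4 := invFactorial_sub_one (m + 1 - k)
    rw [show (k : ℤ) + 1 - 1 = k by ring] at g1
    rw [show (m : ℤ) + 2 - k - 1 = m + 1 - k by ring] at g3
    rw [show (m : ℤ) + 1 - k - 1 = m - k by ring] at g4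
    have c1 : (((k + 1 : ℕ) : ℤ)) = k + 1 := by push_cast; ring
    have c2 : ((k : ℤ) + 1 - 1) = k := by ring
    have c3 : (((m + 2 : ℕ) : ℤ) - (k + 1)) = m + 1 - k := by push_cast; ring
    have c4 : ((m : ℤ) + 1 - k + 1) = m + 2 - k := by ring
    have c5 : (((m + 1 : ℕ) : ℤ) - (k + 1)) = m - k := by push_cast; ring
    have c6 : ((m : ℤ) - k + 1) = m + 1 - k := by ring
    have c7 : (((m + 1 : ℕ) : ℤ) - k) = m + 1 - k := by push_cast; ring
    have c8 : (((m + 2 + 1 : ℕ) : ℤ) - (k + 1)) = m + 2 - k := by push_cast; ring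
    have f1 : m + 2 - 1 = m + 1 := by omega
    have f2 : m + 1 - 1 = m := by omega
    have f3 : m + 2 - 2 = m := by omega
    rw [f1, f2, f3, c1, c2, c3, c4, c5, c6, c7, c8, c4, g4, g3, g2, g1,
      Nat.factorial_succ (m + 2), Nat.factorial_succ (m + 1), Nat.factorial_succ m]
    have : ((m : ℚ) + 2 + 1) ≠ 0 := by positivity
    push_cast
    field_simp
    ring
  rw [coeff_sub]
  linear_combination (h3 + key) / 2

end NarayanaNumbers

/-! ### Bound for the number of trees, and trees as sets of chords -/

section TreeCount

open BinaryTree Finset Polynomial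

/-- As `longCount` is `0` or `1` here, `1 - longCount` is the indicator of the trees to be counted,
so they are counted by a coefficient of `blackPoly - longPoly`. -/
theorem card_trees_le {n : ℕ} (hn : 2 ≤ n) (he : Even n) (k : ℕ) :
    (((treesOfNumNodesEq n).filter fun t =>
      blackCount true t = k + 1 ∧ longCount n true t = 0).card : ℚ) ≤ narayana 1 n (n / 2) / 2 := by
  have h := coeff_blackPoly_sub_longPoly hn he k
  have h1 : (blackPoly true n - longPoly n true n).coeff (k + 1) = ∑ t ∈ treesOfNumNodesEq n,
      if blackCount true t = k + 1 then (1 - (longCount n true t : ℚ)) else 0 := by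
    rw [blackPoly, longPoly, ← sum_sub_distrib, finsetSum_coeff]
    refine sum_congr rfl fun t _ => ?_
    have : (X ^ blackCount true t - (longCount n true t : ℚ[X]) * X ^ blackCount true t : ℚ[X])
        = C (1 - (longCount n true t : ℚ)) * X ^ blackCount true t := by
      rw [map_sub, map_one, map_intCast]; ring
    rw [this, coeff_C_mul_X_pow]
    simp only [eq_comm]
  have h2 : (((treesOfNumNodesEq n).filter fun t =>
      blackCount true t = k + 1 ∧ longCount n true t = 0).card : ℚ)
      ≤ (blackPoly true n - longPoly n true n).coeff (k + 1) := by
    rw [h1, card_filter]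
    push_cast
    refine sum_le_sum fun t ht => ?_
    rw [mem_treesOfNumNodesEq] at ht
    have h3 := longCount_eq_zero_or true t ht.le
    by_cases hb : blackCount true t = k + 1
    · rcases h3 with h3 | h3
      · simp [hb, h3]
      · simp [hb, h3, boolSign]
    · simp [hb]
  refine h2.trans ?_
  rw [h, narayana]
  obtain ⟨m, rfl⟩ := he
  -- Both binomial coefficients peak at the same place, `k + 1 = m`.
  have c1 : (m + m + 1).choose (k + 1) ≤ (m + m + 1).choose ((m + m) / 2) := by
    have := Nat.choose_le_middle (k + 1) (m + m + 1)
    rwa [show (m + m + 1) / 2 = (m + m) / 2 by omega] at this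
  have c2 : (m + m - 2).choose k ≤ (m + m - 1 - 1).choose ((m + m) / 2 - 1) := by
    have := Nat.choose_le_middle k (m + m - 2)
    rwa [show (m + m - 2) / 2 = (m + m) / 2 - 1 by omega] at this
  have c1' : ((m + m + 1).choose (k + 1) : ℚ) ≤ (m + m + 1).choose ((m + m) / 2) := by
    exact_mod_cast c1
  have c2' : ((m + m - 2).choose k : ℚ) ≤ (m + m - 1 - 1).choose ((m + m) / 2 - 1) := by
    exact_mod_cast c2
  calc _ ≤ 1 / (((m + m : ℕ) : ℚ) + 1) * (m + m + 1).choose ((m + m) / 2)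
        * (m + m - 1 - 1).choose ((m + m) / 2 - 1) := by gcongr
    _ = _ := by push_cast; ring

/-- The pairs of points joined by the chords of the matching coded by a binary tree, on points
numbered from `lo` on. -/
def treeEdges : ℕ → BinaryTree Unit → Finset (ℕ × ℕ)
  | _, .nil => ∅
  | lo, .node _ l r => insert (lo, lo + 2 * l.numNodes + 1)
      (treeEdges (lo + 1) l ∪ treeEdges (lo + 2 * l.numNodes + 2) r)

theorem mem_treeEdges_bounds {lo : ℕ} {t : BinaryTree Unit} {x y : ℕ}
    (h : (x, y) ∈ treeEdges lo t) :
    lo ≤ x ∧ x < y ∧ y < lo + 2 * t.numNodes ∧ (x + y) % 2 = 1 := by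
  induction t generalizing lo with
  | nil => simp [treeEdges] at h
  | node _ l r hl hr =>
    rw [treeEdges, mem_insert, mem_union, Prod.mk.injEq] at h
    rw [numNodes]
    rcases h with h | h | h
    · omega
    · have := hl h; omega
    · have := hr h; omega

theorem sum_treeEdges_node {A : Type*} [AddCommMonoid A] (F : ℕ × ℕ → A) (lo : ℕ) (u : Unit)
    (l r : BinaryTree Unit) :
    ∑ e ∈ treeEdges lo (.node u l r), F e = F (lo, lo + 2 * l.numNodes + 1)
      + (∑ e ∈ treeEdges (lo + 1) l, F e + ∑ e ∈ treeEdges (lo + 2 * l.numNodes + 2) r, F e) := by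
  rw [treeEdges, sum_insert, sum_union]
  · rw [disjoint_left]
    rintro ⟨x, y⟩ h1 h2
    have := mem_treeEdges_bounds h1
    have := mem_treeEdges_bounds h2
    omega
  · rw [mem_union]
    rintro (h | h) <;> have := mem_treeEdges_bounds h <;> omega

/-- Each region other than the base lies directly inside a unique chord, and it is black exactly
when that chord starts at an odd point. -/
theorem blackCount_eq_sum (lo : ℕ) (t : BinaryTree Unit) :
    (blackCount (decide (lo % 2 = 0)) t : ℤ) = (if lo % 2 = 0 then 1 else 0)
      + ∑ e ∈ treeEdges lo t, if e.1 % 2 = 1 then 1 else 0 := by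
  induction t generalizing lo with
  | nil => by_cases h : lo % 2 = 0 <;> simp [treeEdges, blackCount, h]
  | node _ l r hl hr =>
    rw [sum_treeEdges_node, blackCount]
    have h1 := hl (lo + 1)
    have h2 := hr (lo + 2 * l.numNodes + 2)
    rw [show (lo + 2 * l.numNodes + 2) % 2 = lo % 2 by omega] at h2
    have e : (!decide (lo % 2 = 0)) = decide ((lo + 1) % 2 = 0) := by
      rw [← decide_not, decide_eq_decide]; omega
    rw [e, Nat.cast_add, h1, h2]
    rcases Nat.mod_two_eq_zero_or_one lo with h | h
    · have h' : (lo + 1) % 2 = 1 := by omega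
      simp [h, h']; ring
    · have h' : (lo + 1) % 2 = 0 := by omega
      simp [h, h']; ring

theorem longCount_eq_sum (n lo : ℕ) (t : BinaryTree Unit) :
    longCount n (decide (lo % 2 = 0)) t = ∑ e ∈ treeEdges lo t,
      if n < e.2 - e.1 then (if e.1 % 2 = 0 then 1 else -1) else 0 := by
  induction t generalizing lo with
  | nil => simp [treeEdges, longCount]
  | node _ l r hl hr =>
    rw [sum_treeEdges_node, longCount]
    have h1 := hl (lo + 1)
    have h2 := hr (lo + 2 * l.numNodes + 2)
    rw [show (lo + 2 * l.numNodes + 2) % 2 = lo % 2 by omega] at h2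
    have e : (!decide (lo % 2 = 0)) = decide ((lo + 1) % 2 = 0) := by
      rw [← decide_not, decide_eq_decide]; omega
    rw [e, h1, h2, show lo + 2 * l.numNodes + 1 - lo = 2 * l.numNodes + 1 by omega, add_assoc]
    simp [boolSign]

/-- The chord at `lo` splits the interval into the points under it and those beyond it. By
noncrossing `f` preserves both parts, and these give the two subtrees. -/
theorem exists_tree_of_noncrossing (f : ℕ → ℕ) (lo hi : ℕ) (hle : lo ≤ hi)
    (hmaps : ∀ x, lo ≤ x → x < hi → lo ≤ f x ∧ f x < hi)
    (hinv : ∀ x, lo ≤ x → x < hi → f (f x) = x)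
    (hne : ∀ x, lo ≤ x → x < hi → f x ≠ x)
    (hnc : ∀ x y, lo ≤ x → x < y → y < f x → f x < hi → x < f y ∧ f y < f x) :
    ∃ t : BinaryTree Unit, hi = lo + 2 * t.numNodes ∧
      ∀ x y, (x, y) ∈ treeEdges lo t ↔ lo ≤ x ∧ x < hi ∧ x < y ∧ f x = y := by
  induction h : hi - lo using Nat.strong_induction_on generalizing lo hi with
  | _ d ih =>
    rcases hle.eq_or_lt with rfl | hlt
    · refine ⟨.nil, by simp, fun x y => ?_⟩
      simp only [treeEdges, notMem_empty, false_iff]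
      omega
    · have hj := hmaps lo le_rfl hlt
      have hj2 := hne lo le_rfl hlt
      have hj3 := hinv lo le_rfl hlt
      set j := f lo with hjdef
      obtain ⟨l, hl, hl'⟩ := ih (j - (lo + 1)) (by omega) (lo + 1) j (by omega)
        (fun x h1 h2 => by
          have := hnc lo x le_rfl (by omega) (by omega) (by omega)
          omega)
        (fun x h1 h2 => hinv x (by omega) (by omega))
        (fun x h1 h2 => hne x (by omega) (by omega))
        (fun x y h1 h2 h3 h4 => hnc x y (by omega) h2 h3 (by omega)) rfl
      obtain ⟨r, hr, hr'⟩ := ih (hi - (j + 1)) (by omega) (j + 1) hi (by omega)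
        (fun x h1 h2 => by
          have a1 := hmaps x (by omega) h2
          have a2 := hinv x (by omega) h2
          refine ⟨?_, a1.2⟩
          by_contra! hcon
          rcases eq_or_ne (f x) j with e | e
          · rw [e] at a2; omega
          rcases eq_or_ne (f x) lo with e' | e'
          · rw [e'] at a2; omega
          have := hnc lo (f x) le_rfl (by omega) (by omega) (by omega)
          omega)
        (fun x h1 h2 => hinv x (by omega) (by omega))
        (fun x h1 h2 => hne x (by omega) (by omega))
        (fun x y h1 h2 h3 h4 => hnc x y (by omega) h2 h3 (by omega)) rfl
      refine ⟨.node () l r, by rw [numNodes]; omega, fun x y => ?_⟩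
      rw [treeEdges, mem_insert, mem_union, hl', show lo + 2 * l.numNodes + 2 = j + 1 by omega,
        hr', Prod.mk.injEq]
      constructor
      · rintro (⟨rfl, rfl⟩ | h1 | h1)
        · omega
        · omega
        · omega
      · rintro ⟨h1, h2, h3, h4⟩
        rcases eq_or_ne x lo with rfl | hx
        · left; omega
        rcases eq_or_ne x j with rfl | hx'
        · omega
        · omega

end TreeCount

/-! ### Matchings coded by trees, and the shape of a flip -/

section Matchings

open BinaryTree Finset

variable {n : ℕ}

namespace NCMatching

theorem exists_mk_mem (M : NCMatching n) (i : Fin (2 * n)) : ∃ j, s(i, j) ∈ M.edges := by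
  obtain ⟨e, ⟨he, hi⟩, -⟩ := M.perfect i
  obtain ⟨j, rfl⟩ := hi
  exact ⟨j, he⟩

theorem mk_mem_unique (M : NCMatching n) {i j k : Fin (2 * n)} (h1 : s(i, j) ∈ M.edges)
    (h2 : s(i, k) ∈ M.edges) : j = k :=
  Sym2.congr_right.1 (M.eq_of_mem h1 h2 (Sym2.mem_mk_left i j) (Sym2.mem_mk_left i k))

theorem not_crossing (M : NCMatching n) {a b c d : Fin (2 * n)} (h1 : s(a, b) ∈ M.edges)
    (h2 : s(c, d) ∈ M.edges) : ¬ (a < c ∧ c < b ∧ b < d) := by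
  rintro ⟨hac, hcb, hbd⟩
  have hne : s(a, b) ≠ s(c, d) := by
    rw [Ne, Sym2.eq_iff]
    rintro (⟨h, -⟩ | ⟨h, -⟩)
    · exact hac.ne h
    · exact (hac.trans (hcb.trans hbd)).ne h
  have := M.noncrossing _ h1 _ h2 hne
  rw [disjoint_chord_iff (hac.trans hcb) (hcb.trans hbd) hac.ne
    (hac.trans (hcb.trans hbd)).ne hcb.ne' hbd.ne] at this
  exact this.1 ⟨hac, hcb, hbd⟩

/-- The binary trees that code a matching. -/
theorem exists_tree (M : NCMatching n) : ∃ t : BinaryTree Unit, t.numNodes = n ∧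
    ∀ i j : Fin (2 * n), i < j → (((i : ℕ), (j : ℕ)) ∈ treeEdges 0 t ↔ s(i, j) ∈ M.edges) := by
  choose f hf using M.exists_mk_mem
  have hinv (i) : f (f i) = i := M.mk_mem_unique (hf (f i)) (Sym2.eq_swap ▸ hf i)
  have hne (i) : f i ≠ i := fun h => M.not_isDiag _ (hf i) (by simp [h])
  let g : ℕ → ℕ := fun x => if h : x < 2 * n then f ⟨x, h⟩ else x
  have hg {x : ℕ} (h : x < 2 * n) : g x = f ⟨x, h⟩ := dif_pos h
  have hlt {x : ℕ} (h : x < 2 * n) : g x < 2 * n := by rw [hg h]; exact (f _).2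
  obtain ⟨t, ht, ht'⟩ := exists_tree_of_noncrossing g 0 (2 * n) (Nat.zero_le _)
    (fun x _ h => ⟨Nat.zero_le _, hlt h⟩)
    (fun x _ h => by
      rw [hg (hlt h)]
      conv_rhs => rw [← Fin.val_mk (n := 2 * n) h, ← hinv ⟨x, h⟩]
      congr 2
      exact Fin.ext (hg h))
    (fun x _ h e => hne ⟨x, h⟩ (Fin.ext (by rw [← hg h, e])))
    (fun x y _ hxy hy hx => by
      have hx' : x < 2 * n := by omega
      have hy' : y < 2 * n := by omega
      have h1 : g x = f ⟨x, hx'⟩ := hg hx'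
      have h2 : g y = f ⟨y, hy'⟩ := hg hy'
      have c1 := M.not_crossing (hf ⟨x, hx'⟩) (hf ⟨y, hy'⟩)
      have c2 := M.not_crossing (Sym2.eq_swap ▸ hf ⟨y, hy'⟩ : s(f ⟨y, hy'⟩, ⟨y, hy'⟩) ∈ M.edges)
        (hf ⟨x, hx'⟩)
      have n1 : f ⟨y, hy'⟩ ≠ ⟨x, hx'⟩ := fun h => by
        have := hinv ⟨y, hy'⟩
        rw [h] at this
        rw [this] at h1
        simp only at h1
        omega
      have n2 : f ⟨y, hy'⟩ ≠ f ⟨x, hx'⟩ := fun h => by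
        have := congrArg f h
        rw [hinv, hinv, Fin.mk.injEq] at this
        omega
      simp only [Fin.lt_def, ne_eq, Fin.ext_iff] at c1 c2 n1 n2
      omega)
  refine ⟨t, by omega, fun i j hij => ?_⟩
  rw [ht', hg i.2]
  constructor
  · rintro ⟨-, -, -, h⟩
    rw [← show f i = j from Fin.ext h]
    exact hf i
  · intro h
    exact ⟨Nat.zero_le _, i.2, hij, congrArg Fin.val (M.mk_mem_unique (hf i) h)⟩

/-- A binary tree that codes a matching. -/
noncomputable def tree (M : NCMatching n) : BinaryTree Unit := M.exists_tree.choose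

theorem numNodes_tree (M : NCMatching n) : M.tree.numNodes = n := M.exists_tree.choose_spec.1

theorem mem_treeEdges_tree (M : NCMatching n) {i j : Fin (2 * n)} (h : i < j) :
    ((i : ℕ), (j : ℕ)) ∈ treeEdges 0 M.tree ↔ s(i, j) ∈ M.edges :=
  M.exists_tree.choose_spec.2 i j h

theorem tree_injective : Function.Injective (tree (n := n)) := by
  intro M M' h
  ext e
  induction e using Sym2.ind with
  | _ i j =>
    rcases lt_trichotomy i j with hij | rfl | hij
    · rw [← mem_treeEdges_tree _ hij, ← mem_treeEdges_tree _ hij, h]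
    · exact iff_of_false (fun h => M.not_isDiag _ h (by simp)) (fun h => M'.not_isDiag _ h (by simp))
    · rw [Sym2.eq_swap, ← mem_treeEdges_tree _ hij, ← mem_treeEdges_tree _ hij, h]

/-- The points strictly between the ends of a chord are matched among themselves, so their number is
even. -/
theorem add_mod_two_of_mem (M : NCMatching n) {i j : Fin (2 * n)} (h : s(i, j) ∈ M.edges) :
    ((i : ℕ) + j) % 2 = 1 := by
  rcases lt_trichotomy i j with hij | rfl | hij
  · exact (mem_treeEdges_bounds ((M.mem_treeEdges_tree hij).2 h)).2.2.2
  · exact absurd (by simp) (M.not_isDiag _ h)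
  · rw [Sym2.eq_swap] at h
    have := (mem_treeEdges_bounds ((M.mem_treeEdges_tree hij).2 h)).2.2.2
    omega

end NCMatching

/-- The value at an edge of a function of its smaller and its larger endpoint. -/
def edgeValue {A : Type*} (w : ℕ × ℕ → A) (e : Sym2 (Fin (2 * n))) : A :=
  w ((e.inf : ℕ), (e.sup : ℕ))

theorem edgeValue_mk {A : Type*} (w : ℕ × ℕ → A) {i j : Fin (2 * n)} (h : i < j) :
    edgeValue w s(i, j) = w ((i : ℕ), (j : ℕ)) := by
  simp [edgeValue, h.le]

theorem edgeValue_mk' {A : Type*} (w : ℕ × ℕ → A) {i j : Fin (2 * n)} (h : i < j) :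
    edgeValue w s(j, i) = w ((i : ℕ), (j : ℕ)) := by
  rw [Sym2.eq_swap, edgeValue_mk w h]

namespace NCMatching

/-- The sum of the values of the edges of a matching. -/
def valueSum {A : Type*} [AddCommMonoid A] (w : ℕ × ℕ → A) (M : NCMatching n) : A :=
  ∑ e ∈ M.edges, edgeValue w e

theorem valueSum_eq {A : Type*} [AddCommMonoid A] (w : ℕ × ℕ → A) (M : NCMatching n) :
    M.valueSum w = ∑ e ∈ treeEdges 0 M.tree, w e := by
  have key (e : Sym2 (Fin (2 * n))) (he : e ∈ M.edges) : e.inf < e.sup ∧ s(e.inf, e.sup) = e := by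
    induction e using Sym2.ind with
    | _ i j =>
      rcases lt_trichotomy i j with hij | rfl | hij
      · simp [hij.le, hij]
      · exact absurd (by simp) (M.not_isDiag _ he)
      · simp [hij.le, hij, Sym2.eq_swap]
  refine sum_bij (fun e _ => ((e.inf : ℕ), (e.sup : ℕ))) (fun e he => ?_) (fun e he e' he' h => ?_)
    (fun ⟨x, y⟩ h => ?_) (fun e he => rfl)
  · rw [M.mem_treeEdges_tree (key e he).1, (key e he).2]
    exact he
  · rw [Prod.mk.injEq, ← Fin.ext_iff, ← Fin.ext_iff] at h
    rw [← (key e he).2, ← (key e' he').2, h.1, h.2]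
  · have hb := mem_treeEdges_bounds h
    rw [M.numNodes_tree] at hb
    have hij : (⟨x, by omega⟩ : Fin (2 * n)) < ⟨y, by omega⟩ := hb.2.1
    refine ⟨s(⟨x, by omega⟩, ⟨y, by omega⟩), (M.mem_treeEdges_tree hij).1 h, ?_⟩
    simp [hij.le]

/-- One if the smaller endpoint of the chord is odd, and zero otherwise. -/
def oddStart (e : ℕ × ℕ) : ℤ := if e.1 % 2 = 1 then 1 else 0

/-- The sign of a chord that spans more than `n` points, and zero for the other chords. -/
def longSign (n : ℕ) (e : ℕ × ℕ) : ℤ :=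
  if n < e.2 - e.1 then (if e.1 % 2 = 0 then 1 else -1) else 0

theorem blackCount_tree (M : NCMatching n) :
    (blackCount true M.tree : ℤ) = 1 + M.valueSum oddStart := by
  rw [valueSum_eq]
  exact blackCount_eq_sum 0 M.tree

theorem longCount_tree (M : NCMatching n) :
    longCount n true M.tree = M.valueSum (longSign n) := by
  rw [valueSum_eq]
  exact longCount_eq_sum n 0 M.tree

theorem valueSum_longSign (M : NCMatching n) :
    M.valueSum (longSign n) = 0 ∨ M.valueSum (longSign n) = 1 := by
  rw [← longCount_tree]
  exact longCount_eq_zero_or true _ M.numNodes_tree.le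

theorem card_le_narayana (hn : 2 ≤ n) (he : Even n) (k : ℤ) (s : Finset (NCMatching n))
    (hs : ∀ M ∈ s, M.valueSum oddStart = k ∧ M.valueSum (longSign n) = 0) :
    (s.card : ℚ) ≤ narayana 1 n (n / 2) / 2 := by
  refine le_trans ?_ (card_trees_le hn he k.toNat)
  have : s.card ≤ ((treesOfNumNodesEq n).filter fun t =>
      blackCount true t = k.toNat + 1 ∧ longCount n true t = 0).card := by
    refine card_le_card_of_injOn tree (fun M hM => ?_) tree_injective.injOn
    obtain ⟨h1, h2⟩ := hs M hM
    have h3 := M.blackCount_tree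
    have h4 : 0 ≤ M.valueSum oddStart :=
      sum_nonneg fun e _ => by unfold edgeValue oddStart; split_ifs <;> simp
    rw [mem_coe, mem_filter, mem_treesOfNumNodesEq]
    refine ⟨M.numNodes_tree, by omega, by rw [longCount_tree, h2]⟩
  exact_mod_cast this

end NCMatching

/-- `IsUpFlip M M' p q r s`: the matching `M'` arises from `M` by replacing the edges `pq` and
`rs` with `qr` and `ps`. -/
def IsUpFlip (M M' : NCMatching n) (p q r s : Fin (2 * n)) : Prop :=
  p < q ∧ q < r ∧ r < s ∧ M.edges \ M'.edges = {s(p, q), s(r, s)} ∧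
    M'.edges \ M.edges = {s(q, r), s(p, s)}

theorem IsFlip.edges_sdiff {M M' : NCMatching n} {a b c d : Fin (2 * n)}
    (h1 : s(a, b) ∈ M.edges) (h2 : s(c, d) ∈ M.edges) (h : s(a, b) ≠ s(c, d))
    (hM : M'.edges = (M.edges \ {s(a, b), s(c, d)}) ∪ {s(b, c), s(d, a)}) :
    M.edges \ M'.edges = {s(a, b), s(c, d)} ∧ M'.edges \ M.edges = {s(b, c), s(d, a)} := by
  obtain ⟨hab, hac, had, hbc, hbd, hcd⟩ := M.four_distinct h1 h2 h
  have h3 : s(b, c) ∉ M.edges := fun h3 => hac (M.mk_mem_unique (Sym2.eq_swap ▸ h1) h3)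
  have h4 : s(d, a) ∉ M.edges := fun h4 => hbd (M.mk_mem_unique h1 (Sym2.eq_swap ▸ h4))
  constructor
  · ext g
    rw [hM]
    simp only [mem_sdiff, mem_union, mem_insert, mem_singleton]
    constructor
    · tauto
    · rintro (rfl | rfl)
      · refine ⟨h1, ?_⟩
        rintro (h5 | h5 | h5)
        · exact h5.2 (.inl rfl)
        · exact h3 (h5 ▸ h1)
        · exact h4 (h5 ▸ h1)
      · refine ⟨h2, ?_⟩
        rintro (h5 | h5 | h5)
        · exact h5.2 (.inr rfl)
        · exact h3 (h5 ▸ h2)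
        · exact h4 (h5 ▸ h2)
  · ext g
    rw [hM]
    simp only [mem_sdiff, mem_union, mem_insert, mem_singleton]
    constructor
    · tauto
    · rintro (rfl | rfl)
      · exact ⟨.inr (.inl rfl), h3⟩
      · exact ⟨.inr (.inr rfl), h4⟩

/-- Noncrossing of both matchings forces `a, b, c, d` into cyclic order, in one direction or the
other. Up to exchanging the matchings, the outermost chord `ps` is among the new ones. -/
theorem IsFlip.exists_isUpFlip {M M' : NCMatching n} (h : IsFlip M M') :
    ∃ p q r s, IsUpFlip M M' p q r s ∨ IsUpFlip M' M p q r s := by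
  obtain ⟨a, b, c, d, h1, h2, h12, -, hM⟩ := h
  obtain ⟨hab, hac, had, hbc, hbd, hcd⟩ := M.four_distinct h1 h2 h12
  have h3 : s(b, c) ∈ M'.edges := by rw [hM]; simp
  have h4 : s(d, a) ∈ M'.edges := by rw [hM]; simp
  obtain ⟨e1, e2⟩ := IsFlip.edges_sdiff h1 h2 h12 hM
  clear hM h12
  -- Symmetries of the labelling that preserve the pairs `ab, cd` and `bc, da` bring any of the four
  -- points to the place of `a`.
  wlog hmin : a < b ∧ a < c ∧ a < d generalizing a b c d
  · have hcase : (b < a ∧ b < d ∧ b < c) ∨ (c < d ∧ c < a ∧ c < b) ∨ (d < c ∧ d < b ∧ d < a) := by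
      simp only [Fin.lt_def, ne_eq, Fin.ext_iff] at *
      omega
    rcases hcase with h | h | h
    · refine this b a d c (Sym2.eq_swap ▸ h1) (Sym2.eq_swap ▸ h2) hab.symm hbd hbc had hac hcd.symm
        (Sym2.eq_swap ▸ h4) (Sym2.eq_swap ▸ h3) ?_ ?_ h
      · rw [e1, Sym2.eq_swap, Sym2.eq_swap (a := c)]
      · rw [e2, Sym2.eq_swap, Sym2.eq_swap (a := d), pair_comm]
    · exact this c d a b h2 h1 hcd hac.symm hbc.symm had.symm hbd.symm hab h4 h3
        (by rw [e1, pair_comm]) (by rw [e2, pair_comm]) h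
    · refine this d c b a (Sym2.eq_swap ▸ h2) (Sym2.eq_swap ▸ h1) hcd.symm hbd.symm had.symm
        hbc.symm hac.symm hab.symm (Sym2.eq_swap ▸ h3) (Sym2.eq_swap ▸ h4) ?_ ?_ h
      · rw [e1, Sym2.eq_swap, Sym2.eq_swap (a := c), pair_comm]
      · rw [e2, Sym2.eq_swap, Sym2.eq_swap (a := d)]
  have c1 := M.not_crossing h1 h2
  have c2 := M.not_crossing h1 (Sym2.eq_swap ▸ h2 : s(d, c) ∈ M.edges)
  have c3 := M'.not_crossing (Sym2.eq_swap ▸ h4 : s(a, d) ∈ M'.edges) h3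
  have c4 := M'.not_crossing (Sym2.eq_swap ▸ h4 : s(a, d) ∈ M'.edges)
    (Sym2.eq_swap ▸ h3 : s(c, b) ∈ M'.edges)
  have hcase : (a < b ∧ b < c ∧ c < d) ∨ (a < d ∧ d < c ∧ c < b) := by
    simp only [Fin.lt_def, ne_eq, Fin.ext_iff] at *
    omega
  rcases hcase with h | h
  · refine ⟨a, b, c, d, .inl ⟨h.1, h.2.1, h.2.2, e1, ?_⟩⟩
    rw [e2, Sym2.eq_swap (a := a)]
  · refine ⟨a, d, c, b, .inr ⟨h.1, h.2.1, h.2.2, ?_, ?_⟩⟩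
    · rw [e2, pair_comm, Sym2.eq_swap (a := b), Sym2.eq_swap (a := a)]
    · rw [e1, pair_comm, Sym2.eq_swap (a := c)]

end Matchings

/-! ### Effect of a flip on the weights -/

section FlipWeights

open Finset

variable {n : ℕ}

theorem NCMatching.valueSum_sub_valueSum {A : Type*} [AddCommGroup A] (w : ℕ × ℕ → A)
    (M M' : NCMatching n) : M'.valueSum w - M.valueSum w =
      ∑ e ∈ M'.edges \ M.edges, edgeValue w e - ∑ e ∈ M.edges \ M'.edges, edgeValue w e :=
  sum_sdiff_sub_sum_sdiff.symm

namespace IsUpFlip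

variable {M M' : NCMatching n} {p q r s : Fin (2 * n)}

theorem sum_removed {A : Type*} [AddCommMonoid A] (h : IsUpFlip M M' p q r s) (w : ℕ × ℕ → A) :
    ∑ e ∈ M.edges \ M'.edges, edgeValue w e
      = w ((p : ℕ), (q : ℕ)) + w ((r : ℕ), (s : ℕ)) := by
  obtain ⟨h1, h2, h3, h4, -⟩ := h
  rw [h4, sum_pair, edgeValue_mk w h1, edgeValue_mk w h3]
  rw [Ne, Sym2.eq_iff]
  rintro (⟨h, -⟩ | ⟨h, -⟩)
  · exact (h1.trans h2).ne h
  · exact (h1.trans (h2.trans h3)).ne h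

theorem sum_added {A : Type*} [AddCommMonoid A] (h : IsUpFlip M M' p q r s) (w : ℕ × ℕ → A) :
    ∑ e ∈ M'.edges \ M.edges, edgeValue w e
      = w ((q : ℕ), (r : ℕ)) + w ((p : ℕ), (s : ℕ)) := by
  obtain ⟨h1, h2, h3, -, h5⟩ := h
  rw [h5, sum_pair, edgeValue_mk w h2, edgeValue_mk w (h1.trans (h2.trans h3))]
  rw [Ne, Sym2.eq_iff]
  rintro (⟨h, -⟩ | ⟨h, -⟩)
  · exact h1.ne h.symm
  · exact (h2.trans h3).ne h

theorem parity (h : IsUpFlip M M' p q r s) :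
    ((p : ℕ) + q) % 2 = 1 ∧ ((q : ℕ) + r) % 2 = 1 ∧ ((r : ℕ) + s) % 2 = 1 := by
  obtain ⟨-, -, -, h4, h5⟩ := h
  have h1 : s(p, q) ∈ M.edges \ M'.edges := by rw [h4]; simp
  have h2 : s(r, s) ∈ M.edges \ M'.edges := by rw [h4]; simp
  have h3 : s(q, r) ∈ M'.edges \ M.edges := by rw [h5]; simp
  exact ⟨M.add_mod_two_of_mem (mem_sdiff.1 h1).1, M'.add_mod_two_of_mem (mem_sdiff.1 h3).1,
    M.add_mod_two_of_mem (mem_sdiff.1 h2).1⟩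

end IsUpFlip

/-- Twice the number of steps between the ends of a chord along the shorter arc, minus `n`. -/
def lengthWeight (n : ℕ) (e : ℕ × ℕ) : ℤ :=
  2 * min ((e.2 : ℤ) - e.1) (2 * n - ((e.2 : ℤ) - e.1)) - n

/-- The sum of the values of the edges that appear in the step from `M` to `M'`. -/
def addedSum {A : Type*} [AddCommMonoid A] (w : ℕ × ℕ → A) (M M' : NCMatching n) : A :=
  ∑ e ∈ M'.edges \ M.edges, edgeValue w e

theorem IsFlip.addedSum_one {M M' : NCMatching n} (h : IsFlip M M') :
    addedSum (fun _ => (1 : ℤ)) M M' = 1 + 1 := by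
  obtain ⟨p, q, r, s, h | h⟩ := h.exists_isUpFlip
  · exact h.sum_added _
  · exact h.sum_removed _

/-- The arcs `pq`, `qr`, `rs` and the arc from `s` round to `p` have total length `2 * n`, and each
bounds the corresponding minimum from above. -/
theorem IsFlip.addedSum_lengthWeight_le {M M' : NCMatching n} (h : IsFlip M M') :
    addedSum (lengthWeight n) M M' + addedSum (lengthWeight n) M' M ≤ 0 := by
  obtain ⟨p, q, r, s, h | h⟩ := h.exists_isUpFlip
  all_goals
    rw [addedSum, addedSum, h.sum_added, h.sum_removed]
    unfold lengthWeight
    omega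

/-- In a flip whose quadrilateral has no side that spans more than `n` points, the value
`oddStart - longSign` does not change, and `longSign` switches between `0` and `1`. -/
theorem IsFlip.valueSum_eq_and_add_eq_one (he : Even n) {M M' : NCMatching n} (h : IsFlip M M')
    (h0 : 0 ≤ addedSum (lengthWeight n) M M' + addedSum (lengthWeight n) M' M) :
    M.valueSum NCMatching.oddStart - M.valueSum (NCMatching.longSign n)
      = M'.valueSum NCMatching.oddStart - M'.valueSum (NCMatching.longSign n) ∧
    M.valueSum (NCMatching.longSign n) + M'.valueSum (NCMatching.longSign n) = 1 := by
  obtain ⟨p, q, r, s, h | h⟩ := h.exists_isUpFlip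
  all_goals
    have h1 := NCMatching.valueSum_sub_valueSum NCMatching.oddStart M M'
    have h2 := NCMatching.valueSum_sub_valueSum (NCMatching.longSign n) M M'
    rw [addedSum, addedSum] at h0
    rw [h.sum_added, h.sum_removed] at h0 h1 h2
    have c1 := M.valueSum_longSign
    have c2 := M'.valueSum_longSign
    obtain ⟨p1, p2, p3⟩ := h.parity
    obtain ⟨l1, l2, l3, -, -⟩ := h
    obtain ⟨m, hm⟩ := he
    rw [Fin.lt_def] at l1 l2 l3
    -- Equality in the weight bound makes every arc at most `n`; strictness holds since the arcs are
    -- odd and `n` is even.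
    have g1 : (q : ℕ) - p < n := by unfold lengthWeight at h0; omega
    have g2 : (r : ℕ) - q < n := by unfold lengthWeight at h0; omega
    have g3 : (s : ℕ) - r < n := by unfold lengthWeight at h0; omega
    have g4 : n < (s : ℕ) - p := by unfold lengthWeight at h0; omega
    clear h0
    simp only [NCMatching.oddStart, NCMatching.longSign, if_neg g1.not_gt, if_neg g2.not_gt,
      if_neg g3.not_gt, if_pos g4] at h1 h2
    -- Replacing `pq, rs` by `qr, ps` changes both sums by `1` if `p` is even and by `-1` if `p` is
    -- odd.
    rcases Nat.mod_two_eq_zero_or_one p with hp | hp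
    · have hq : (q : ℕ) % 2 = 1 := by omega
      have hr : (r : ℕ) % 2 = 0 := by omega
      simp [hp, hq, hr] at h1 h2
      omega
    · have hq : (q : ℕ) % 2 = 0 := by omega
      have hr : (r : ℕ) % 2 = 1 := by omega
      simp [hp, hq, hr] at h1 h2
      omega

end FlipWeights

/-! ### Sums along walks -/

section Walks

open Finset

variable {n : ℕ}

theorem SimpleGraph.Walk.sum_darts_sub {V : Type*} {G : SimpleGraph V} {A : Type*}
    [AddCommGroup A] (F : V → A) {u v : V} (p : G.Walk u v) :
    (p.darts.map fun d => F d.snd - F d.fst).sum = F v - F u := by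
  induction p with
  | nil => simp
  | cons h p ih => simp [ih]

theorem SimpleGraph.Walk.eq_of_forall_darts {V : Type*} {G : SimpleGraph V} {A : Type*}
    (F : V → A) {u v : V} (p : G.Walk u v) (h : ∀ d ∈ p.darts, F d.fst = F d.snd) :
    ∀ x ∈ p.support, F x = F u := by
  induction p with
  | nil => simp
  | cons h' p ih =>
    simp only [SimpleGraph.Walk.darts_cons, List.forall_mem_cons] at h
    rw [SimpleGraph.Walk.support_cons, List.forall_mem_cons]
    refine ⟨rfl, fun x hx => ?_⟩
    rw [ih h.2 x hx]
    exact h.1.symm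

/-- Double counting of pairs of a flip and an edge that it adds. -/
theorem sum_mul_appearances (w : ℕ × ℕ → ℤ) {M M' : NCMatching n} (p : (flipGraph n).Walk M M') :
    ∑ e, edgeValue w e * (appearances p e : ℤ)
      = (p.darts.map fun d => addedSum w d.fst d.snd).sum := by
  induction p with
  | nil => simp [appearances]
  | @cons M₁ M₂ M₃ h p ih =>
    have e1 (e : Sym2 (Fin (2 * n))) : (appearances (.cons h p) e : ℤ)
        = appearances p e + if e ∈ M₂.edges \ M₁.edges then 1 else 0 := by
      simp only [appearances, SimpleGraph.Walk.darts_cons, List.countP_cons, mem_sdiff, and_comm]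
      push_cast
      simp
    simp only [e1, mul_add, sum_add_distrib, ih, SimpleGraph.Walk.darts_cons, List.map_cons,
      List.sum_cons, mul_ite, mul_one, mul_zero, addedSum]
    rw [add_comm, ← sum_filter, filter_mem_eq_inter, univ_inter]

theorem appearances_eq_zero {M M' : NCMatching n} (p : (flipGraph n).Walk M M')
    {e : Sym2 (Fin (2 * n))} (h : ¬ IsPossibleEdge e) : appearances p e = 0 := by
  rw [appearances, List.countP_eq_zero]
  intro d _
  simp only [decide_eq_true_eq, not_and]
  exact fun _ h' => h ⟨_, h'⟩

end Walks

/-! ### The possible edges and their total weight -/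

section PossibleEdges

open Finset

variable {n : ℕ}

/-- The matching that joins each point to its image under a noncrossing involution. -/
def NCMatching.ofInvolution (f : Fin (2 * n) → Fin (2 * n)) (hinv : ∀ x, f (f x) = x)
    (hne : ∀ x, f x ≠ x) (hnc : ∀ x y, x < y → y < f x → ¬ f x < f y) : NCMatching n where
  edges := univ.image fun x => s(x, f x)
  not_isDiag := by
    intro e he
    obtain ⟨x, -, rfl⟩ := mem_image.1 he
    simpa using (hne x).symm
  perfect := by
    intro i
    refine ⟨s(i, f i), ⟨mem_image_of_mem _ (mem_univ i), Sym2.mem_mk_left _ _⟩, ?_⟩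
    rintro e ⟨he, hi⟩
    obtain ⟨x, -, rfl⟩ := mem_image.1 he
    rcases Sym2.mem_iff.1 hi with rfl | rfl
    · rfl
    · rw [hinv, Sym2.eq_swap]
  noncrossing := by
    have key (x : Fin (2 * n)) : ∃ y, y < f y ∧ s(x, f x) = s(y, f y) := by
      rcases lt_or_gt_of_ne (hne x) with h | h
      · exact ⟨f x, by rwa [hinv], by rw [hinv, Sym2.eq_swap]⟩
      · exact ⟨x, h, rfl⟩
    intro e he g hg heg
    obtain ⟨x, -, rfl⟩ := mem_image.1 he
    obtain ⟨y, -, rfl⟩ := mem_image.1 hg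
    obtain ⟨x, hx, ex⟩ := key x
    obtain ⟨y, hy, ey⟩ := key y
    rw [ex, ey] at heg ⊢
    have h1 : x ≠ y := fun h => heg (by rw [h])
    have h2 : x ≠ f y := fun h => heg (by rw [h, hinv, Sym2.eq_swap])
    have h3 : f x ≠ y := fun h => heg (by rw [← h, hinv, Sym2.eq_swap])
    have h4 : f x ≠ f y := fun h => h1 (by rw [← hinv x, h, hinv])
    rw [disjoint_chord_iff hx hy h1 h2 h3 h4]
    exact ⟨fun h => hnc x y h.1 h.2.1 h.2.2, fun h => hnc y x h.1 h.2.1 h.2.2⟩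

/-- Besides `ij`, neighbouring points are joined: within the interval between `i` and `j`, and
cyclically outside it, where `0` and `N - 1` may form a pair. -/
theorem exists_noncrossing_involution {N i j : ℕ} (hN : N % 2 = 0) (hij : i < j) (hj : j < N)
    (hpar : (i + j) % 2 = 1) : ∃ g : ℕ → ℕ, g i = j ∧ (∀ x < N, g x < N) ∧ (∀ x < N, g x ≠ x) ∧
      (∀ x < N, g (g x) = x) ∧ ∀ x y, x < N → y < N → x < y → y < g x → ¬ g x < g y := by
  obtain ⟨g, spec⟩ : ∃ g : ℕ → ℕ, ∀ x : ℕ, (x = i ∧ g x = j) ∨ (x = j ∧ g x = i) ∨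
      (i < x ∧ x < j ∧ (x + i) % 2 = 1 ∧ g x = x + 1) ∨
      (i < x ∧ x < j ∧ (x + i) % 2 = 0 ∧ g x = x - 1) ∨
      ((x < i ∨ j < x) ∧ (x + i) % 2 = 0 ∧ x + 1 = N ∧ g x = 0) ∨
      ((x < i ∨ j < x) ∧ (x + i) % 2 = 0 ∧ x + 1 ≠ N ∧ g x = x + 1) ∨
      ((x < i ∨ j < x) ∧ (x + i) % 2 = 1 ∧ x = 0 ∧ g x = N - 1) ∨
      ((x < i ∨ j < x) ∧ (x + i) % 2 = 1 ∧ x ≠ 0 ∧ g x = x - 1) := by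
    refine ⟨fun x => if x = i then j else if x = j then i else
      if i < x ∧ x < j then (if (x + i) % 2 = 1 then x + 1 else x - 1) else
      if (x + i) % 2 = 0 then (if x + 1 = N then 0 else x + 1) else
      if x = 0 then N - 1 else x - 1, fun x => ?_⟩
    dsimp only
    split_ifs
    · left; omega
    · right; left; omega
    · right; right; left; omega
    · right; right; right; left; omega
    · right; right; right; right; left; omega
    · right; right; right; right; right; left; omega
    · right; right; right; right; right; right; left; omega
    · right; right; right; right; right; right; right; omega
  have hi : g i = j := by have := spec i; omega
  have hg (x : ℕ) (hx : x < N) : g x < N ∧ g x ≠ x := by have := spec x; omega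
  have hin (x : ℕ) (h1 : i < x) (h2 : x < j) : g x < j := by have := spec x; omega
  have hgt (x : ℕ) (h : x + 1 < g x) : x = i ∨ g x = N - 1 := by have := spec x; omega
  refine ⟨g, hi, fun x hx => (hg x hx).1, fun x hx => (hg x hx).2, fun x hx => ?_,
    fun x y hx hy hxy h => ?_⟩
  · have h2 := spec (g x)
    rcases spec x with h1 | h1 | h1 | h1 | h1 | h1 | h1 | h1
    · rw [h1.2] at h2 ⊢; omega
    · rw [h1.2] at h2 ⊢; omega
    · rw [h1.2.2.2] at h2 ⊢; omega
    · rw [h1.2.2.2] at h2 ⊢; omega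
    · rw [h1.2.2.2] at h2 ⊢; omega
    · rw [h1.2.2.2] at h2 ⊢; omega
    · rw [h1.2.2.2] at h2 ⊢; omega
    · rw [h1.2.2.2] at h2 ⊢; omega
  · rcases hgt x (by omega) with rfl | h1
    · have := hin y hxy (by omega)
      omega
    · have := (hg y hy).1
      omega

theorem isPossibleEdge_of_lt {i j : Fin (2 * n)} (hij : i < j) (hpar : ((i : ℕ) + j) % 2 = 1) :
    IsPossibleEdge s(i, j) := by
  obtain ⟨g, hi, hlt, hne, hgg, hnc⟩ :=
    exists_noncrossing_involution (Nat.mul_mod_right 2 n) hij j.2 hpar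
  refine ⟨NCMatching.ofInvolution (fun x => ⟨g x, hlt x x.2⟩) (fun x => Fin.ext (hgg x x.2))
    (fun x h => hne x x.2 (congrArg Fin.val h)) (fun x y => hnc x y x.2 y.2), ?_⟩
  refine mem_image.2 ⟨i, mem_univ i, ?_⟩
  exact congrArg (fun z => s(i, z)) (Fin.ext hi)

/-- The edge that joins the `x`-th even point to the `y`-th odd point. -/
def evenOddEdge (n : ℕ) (z : Fin n × Fin n) : Sym2 (Fin (2 * n)) :=
  s(⟨2 * z.1, by omega⟩, ⟨2 * z.2 + 1, by omega⟩)

theorem evenOddEdge_injective : Function.Injective (evenOddEdge n) := by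
  rintro ⟨x, y⟩ ⟨x', y'⟩ h
  rw [evenOddEdge, evenOddEdge, Sym2.eq_iff] at h
  simp only [Fin.mk.injEq] at h
  ext <;> simp only <;> omega

theorem isPossibleEdge_evenOddEdge (z : Fin n × Fin n) : IsPossibleEdge (evenOddEdge n z) := by
  obtain ⟨x, y⟩ := z
  rcases Nat.lt_or_ge (2 * (x : ℕ)) (2 * y + 1) with h | h
  · exact isPossibleEdge_of_lt h (by simp only; omega)
  · rw [evenOddEdge, Sym2.eq_swap]
    refine isPossibleEdge_of_lt ?_ (by simp only; omega)
    rw [Fin.lt_def]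
    simp only
    omega

theorem exists_evenOddEdge_eq {e : Sym2 (Fin (2 * n))} (h : IsPossibleEdge e) :
    ∃ z, evenOddEdge n z = e := by
  obtain ⟨M, hM⟩ := h
  induction e using Sym2.ind with
  | _ i j =>
    have := M.add_mod_two_of_mem hM
    rcases Nat.mod_two_eq_zero_or_one i with hi | hi
    · refine ⟨(⟨i / 2, by omega⟩, ⟨j / 2, by omega⟩), ?_⟩
      rw [evenOddEdge]
      congr 2 <;> dsimp only <;> omega
    · refine ⟨(⟨j / 2, by omega⟩, ⟨i / 2, by omega⟩), ?_⟩
      rw [evenOddEdge, Sym2.eq_swap]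
      congr 2 <;> dsimp only <;> omega

theorem edgeValue_lengthWeight (z : Fin n × Fin n) :
    edgeValue (lengthWeight n) (evenOddEdge n z)
      = 2 * min |2 * ((z.2 : ℤ) - (z.1 : ℕ)) + 1| (2 * n - |2 * ((z.2 : ℤ) - (z.1 : ℕ)) + 1|) - n := by
  obtain ⟨x, y⟩ := z
  rw [evenOddEdge]
  rcases Nat.lt_or_ge (2 * (x : ℕ)) (2 * y + 1) with h | h
  · rw [edgeValue_mk _ (Fin.lt_def.2 h), lengthWeight]
    simp only
    rw [abs_of_nonneg (by omega)]
    push_cast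
    congr 3 <;> ring
  · rw [edgeValue_mk' _ (Fin.lt_def.2 (show 2 * (y : ℕ) + 1 < 2 * x by omega)), lengthWeight]
    simp only
    rw [abs_of_nonpos (by omega)]
    push_cast
    congr 3 <;> ring

theorem sum_range_min (n : ℕ) :
    ∑ y ∈ range n, (2 * min (2 * (y : ℤ) + 1) (2 * n - (2 * y + 1)) - n) = n % 2 := by
  have h (m : ℕ) : ∑ y ∈ range m, (2 * (2 * (y : ℤ) + 1)) = 2 * m ^ 2 := by
    induction m with
    | zero => simp
    | succ m ih => rw [sum_range_succ, ih]; push_cast; ring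
  have h' (m : ℕ) (c : ℤ) : ∑ y ∈ range m, (2 * (c - (2 * (y : ℤ) + 1))) = 2 * (c * m - m ^ 2) := by
    induction m with
    | zero => simp
    | succ m ih => rw [sum_range_succ, ih]; push_cast; ring
  have hs : n = (n + 1) / 2 + n / 2 := by omega
  rw [sum_sub_distrib]
  -- The minimum is its first argument exactly for the first `(n + 1) / 2` values of `y`.
  nth_rw 1 [hs]
  rw [sum_range_add]
  have e1 : ∑ y ∈ range ((n + 1) / 2), (2 * min (2 * (y : ℤ) + 1) (2 * n - (2 * y + 1)))
      = 2 * (((n + 1) / 2 : ℕ) : ℤ) ^ 2 := by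
    rw [← h]
    refine sum_congr rfl fun y hy => ?_
    rw [mem_range] at hy
    omega
  have e2 : ∑ y ∈ range (n / 2), (2 * min (2 * (((n + 1) / 2 + y : ℕ) : ℤ) + 1)
      (2 * n - (2 * (((n + 1) / 2 + y : ℕ) : ℤ) + 1)))
      = 2 * ((2 * (n : ℤ) - 2 * ((n + 1) / 2 : ℕ)) * ((n / 2 : ℕ) : ℤ) - ((n / 2 : ℕ) : ℤ) ^ 2) := by
    rw [← h']
    refine sum_congr rfl fun y hy => ?_
    rw [mem_range] at hy
    push_cast
    omega
  rw [e1, e2, sum_const, card_range, nsmul_eq_mul]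
  rcases Nat.even_or_odd' n with ⟨m, rfl | rfl⟩
  · rw [show (2 * m + 1) / 2 = m by omega, show 2 * m / 2 = m by omega,
      show ((2 * m : ℕ) : ℤ) % 2 = 0 by omega]
    push_cast; ring
  · rw [show (2 * m + 1 + 1) / 2 = m + 1 by omega, show (2 * m + 1) / 2 = m by omega,
      show ((2 * m + 1 : ℕ) : ℤ) % 2 = 1 by omega]
    push_cast; ring

/-- Rotational symmetry: moving the even point one place shifts the summands, and the one that
leaves at one end returns with equal value at the other. -/
theorem sum_range_shift (n x : ℕ) (hx : x ≤ n) :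
    ∑ y ∈ range n, (2 * min |2 * ((y : ℤ) - x) + 1| (2 * n - |2 * ((y : ℤ) - x) + 1|) - n)
      = (n : ℤ) % 2 := by
  induction x with
  | zero =>
    rw [← sum_range_min]
    refine sum_congr rfl fun y _ => ?_
    rw [abs_of_nonneg (by omega)]
    simp
  | succ x ih =>
    rw [← ih (by omega)]
    obtain ⟨m, rfl⟩ : ∃ m, n = m + 1 := ⟨n - 1, by omega⟩
    rw [sum_range_succ', sum_range_succ]
    congr 1
    · refine sum_congr rfl fun y _ => ?_
      push_cast
      rw [show (y : ℤ) + 1 - (x + 1) = y - x by ring]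
    · rw [abs_of_nonpos (by push_cast; omega), abs_of_nonneg (by omega)]
      push_cast
      omega

theorem sum_lengthWeight (n : ℕ) :
    ∑ z, edgeValue (lengthWeight n) (evenOddEdge n z) = n * ((n : ℤ) % 2) := by
  rw [Fintype.sum_prod_type]
  have (x : Fin n) : ∑ y, edgeValue (lengthWeight n) (evenOddEdge n (x, y)) = (n : ℤ) % 2 := by
    rw [← sum_range_shift n x x.2.le, Finset.sum_range]
    exact sum_congr rfl fun y _ => edgeValue_lengthWeight (x, y)
  rw [sum_congr rfl fun x _ => this x]
  simp

theorem IsRainbowCycle.sum_darts {r : ℕ} {M : NCMatching n} {p : (flipGraph n).Walk M M}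
    (h : IsRainbowCycle r p) (w : ℕ × ℕ → ℤ) :
    (p.darts.map fun d => addedSum w d.fst d.snd).sum
      = r * ∑ z, edgeValue w (evenOddEdge n z) := by
  classical
  rw [← sum_mul_appearances, mul_sum]
  rw [← sum_subset (subset_univ (univ.image (evenOddEdge n))),
    sum_image evenOddEdge_injective.injOn]
  · exact sum_congr rfl fun z _ => by rw [h.2 _ (isPossibleEdge_evenOddEdge z), mul_comm]
  · intro e _ he
    rw [appearances_eq_zero p, Nat.cast_zero, mul_zero]
    intro hp
    obtain ⟨z, rfl⟩ := exists_evenOddEdge_eq hp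
    exact he (mem_image_of_mem _ (mem_univ z))

end PossibleEdges

/-! ### Rainbow cycles -/

section Rainbow

open Finset

variable {n : ℕ}

theorem List.sum_map_sub_int {ι : Type*} (l : List ι) (f g : ι → ℤ) :
    (l.map fun i => f i - g i).sum = (l.map f).sum - (l.map g).sum := by
  rw [eq_sub_iff_add_eq, ← List.sum_map_add]
  simp

/-- Gains minus losses telescope to zero on a closed walk, so added and removed edges have equal
total weight. -/
theorem sum_map_addedSum_comm {M : NCMatching n} (p : (flipGraph n).Walk M M) (w : ℕ × ℕ → ℤ) :
    (p.darts.map fun d => addedSum w d.fst d.snd + addedSum w d.snd d.fst).sum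
      = 2 * (p.darts.map fun d => addedSum w d.fst d.snd).sum := by
  have h := p.sum_darts_sub (NCMatching.valueSum w)
  simp only [NCMatching.valueSum_sub_valueSum, sub_self] at h
  change (p.darts.map fun d => addedSum w d.fst d.snd - addedSum w d.snd d.fst).sum = 0 at h
  rw [List.sum_map_sub_int] at h
  rw [List.sum_map_add]
  linarith

theorem IsRainbowCycle.sum_lengthWeight {r : ℕ} {M : NCMatching n}
    {p : (flipGraph n).Walk M M} (h : IsRainbowCycle r p) :
    (p.darts.map fun d => addedSum (lengthWeight n) d.fst d.snd
      + addedSum (lengthWeight n) d.snd d.fst).sum = 2 * (r * (n * ((n : ℤ) % 2))) := by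
  rw [sum_map_addedSum_comm, h.sum_darts, _root_.sum_lengthWeight]

theorem not_isRainbowCycle_of_odd {r : ℕ} (hn : Odd n) (hr : 1 ≤ r) {M : NCMatching n}
    (p : (flipGraph n).Walk M M) : ¬ IsRainbowCycle r p := by
  intro h
  have h1 := h.sum_lengthWeight
  have h2 : (p.darts.map fun d => addedSum (lengthWeight n) d.fst d.snd
      + addedSum (lengthWeight n) d.snd d.fst).sum ≤ (p.darts.map fun _ => (0 : ℤ)).sum :=
    List.sum_le_sum fun d _ => IsFlip.addedSum_lengthWeight_le d.adj
  rw [List.map_const', List.sum_replicate, smul_zero] at h2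
  have h3 : (n : ℤ) % 2 = 1 := by
    obtain ⟨m, rfl⟩ := hn
    omega
  have h4 : 0 < n := hn.pos
  rw [h1, h3] at h2
  have : (0 : ℤ) < 2 * (r * (n * 1)) := by positivity
  omega

theorem IsRainbowCycle.two_mul_length {r : ℕ} {M : NCMatching n}
    {p : (flipGraph n).Walk M M} (h : IsRainbowCycle r p) :
    2 * (p.length : ℤ) = r * n ^ 2 := by
  have h1 := h.sum_darts fun _ => 1
  have h2 : (p.darts.map fun d => addedSum (fun _ => (1 : ℤ)) d.fst d.snd)
      = p.darts.map fun _ => 2 :=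
    List.map_congr_left fun d _ => IsFlip.addedSum_one d.adj
  rw [h2, List.map_const', List.sum_replicate, SimpleGraph.Walk.length_darts] at h1
  simp only [edgeValue, sum_const, card_univ, Fintype.card_prod, Fintype.card_fin, nsmul_eq_mul,
    Nat.cast_mul, mul_one] at h1
  rw [mul_comm, h1]
  ring

theorem IsRainbowCycle.le_narayana {r : ℕ} (hn : 2 ≤ n) (he : Even n) {M : NCMatching n}
    {p : (flipGraph n).Walk M M} (h : IsRainbowCycle r p) :
    (r : ℚ) * n ^ 2 / 2 ≤ narayana 1 n (n / 2) := by
  classical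
  have hmod : (n : ℤ) % 2 = 0 := by
    obtain ⟨m, rfl⟩ := he
    omega
  have hsum := h.sum_lengthWeight
  rw [hmod, mul_zero, mul_zero, mul_zero] at hsum
  -- Nonpositive terms with sum zero all vanish, so every flip is centred.
  have hflip (d) (hd : d ∈ p.darts) : 0 ≤ addedSum (lengthWeight n) d.fst d.snd
      + addedSum (lengthWeight n) d.snd d.fst := by
    by_contra! hlt
    have : (p.darts.map fun d => addedSum (lengthWeight n) d.fst d.snd
      + addedSum (lengthWeight n) d.snd d.fst).sum < (p.darts.map fun _ => (0 : ℤ)).sum :=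
      List.sum_lt_sum _ _ (fun d _ => IsFlip.addedSum_lengthWeight_le d.adj) ⟨d, hd, hlt⟩
    rw [hsum] at this
    simp at this
  have hstep (d) (hd : d ∈ p.darts) := IsFlip.valueSum_eq_and_add_eq_one he d.adj (hflip d hd)
  have hconst := p.eq_of_forall_darts
    (fun M => M.valueSum NCMatching.oddStart - M.valueSum (NCMatching.longSign n))
    fun d hd => (hstep d hd).1
  have hdiff := p.sum_darts_sub (NCMatching.valueSum (NCMatching.longSign n))
  have hadd : (p.darts.map fun d => d.fst.valueSum (NCMatching.longSign n)
      + d.snd.valueSum (NCMatching.longSign n)).sum = p.length := by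
    rw [List.map_congr_left fun d hd => (hstep d hd).2, List.map_const', List.sum_replicate,
      SimpleGraph.Walk.length_darts]
    simp
  rw [List.sum_map_sub_int, sub_self] at hdiff
  rw [List.sum_map_add] at hadd
  have hsnd : (p.darts.map fun d => d.snd.valueSum (NCMatching.longSign n)).sum
      = ∑ M ∈ p.support.tail.toFinset, M.valueSum (NCMatching.longSign n) := by
    rw [List.sum_toFinset _ h.1.2, ← SimpleGraph.Walk.map_snd_darts, List.map_map]
    rfl
  -- Distinctness of the vertices turns sums over flips into a count of matchings.
  have hcard : (p.support.tail.toFinset.card : ℤ) = p.length := by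
    rw [List.toFinset_card_of_nodup h.1.2, List.length_tail, SimpleGraph.Walk.length_support,
      Nat.add_sub_cancel]
  have hfilter : ((p.support.tail.toFinset.filter fun M =>
      M.valueSum (NCMatching.longSign n) = 0).card : ℤ)
      = ∑ M ∈ p.support.tail.toFinset, (1 - M.valueSum (NCMatching.longSign n)) := by
    rw [card_filter]
    push_cast
    refine sum_congr rfl fun M _ => ?_
    rcases M.valueSum_longSign with h0 | h0 <;> simp [h0]
  rw [sum_sub_distrib, sum_const, nsmul_eq_mul, mul_one, hcard, ← hsnd] at hfilter
  have hbound := NCMatching.card_le_narayana hn he _ (p.support.tail.toFinset.filter fun M =>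
      M.valueSum (NCMatching.longSign n) = 0) (fun M' hM' => by
    rw [mem_filter, List.mem_toFinset] at hM'
    have := hconst M' (List.mem_of_mem_tail hM'.1)
    rw [hM'.2, sub_zero] at this
    exact ⟨this, hM'.2⟩)
  have hlen := h.two_mul_length
  -- Half of the `p.length` vertices have `longSign` sum `0`, and `2 * p.length = r * n ^ 2`.
  have hfinal : (4 : ℤ) * (p.support.tail.toFinset.filter fun M =>
      M.valueSum (NCMatching.longSign n) = 0).card = r * n ^ 2 := by
    linarith
  have hfinal' : (4 : ℚ) * (p.support.tail.toFinset.filter fun M =>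
      M.valueSum (NCMatching.longSign n) = 0).card = r * n ^ 2 := by
    exact_mod_cast hfinal
  linarith

end Rainbow

theorem theorem6p1 :
    (∀ n r : ℕ, 3 ≤ n → Odd n → 1 ≤ r →
      ¬ ∃ (M : NCMatching n) (p : (flipGraph n).Walk M M), IsRainbowCycle r p) ∧
    (∀ n r : ℕ, 2 ≤ n → Even n → (r : ℚ) > 2 / (n : ℚ) ^ 2 * narayana 1 n (n / 2) →
      ¬ ∃ (M : NCMatching n) (p : (flipGraph n).Walk M M), IsRainbowCycle r p) := by
  refine ⟨fun n r _ hodd hr ⟨M, p, h⟩ => not_isRainbowCycle_of_odd hodd hr p h,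
    fun n r hn he hr ⟨M, p, h⟩ => ?_⟩
  have h1 := h.le_narayana hn he
  have hn0 : (0 : ℚ) < (n : ℚ) ^ 2 := by positivity
  rw [gt_iff_lt, div_mul_eq_mul_div, div_lt_iff₀ hn0] at hr
  linarith
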